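/- **Counting-set automata.** A counting-set automaton (CSA) $A=(X,Q,\Delta,I,F)$ has a finite set $X$ of registers holding sets of natural numbers, a finite set $Q$ of states, and finitely many transitions $q\xrightarrow{a,\varphi,u}p$. The guard $\varphi$ (and each final condition $F(q)$) is a Boolean combination of atoms $t\ge n$, $t<n$, where $t$ is built from $0$, $1$, registers and $+1$; a set satisfies $\ge n$ (resp. $<n$) iff some element of it does. The update $u$ assigns to each register a finite union of r-terms; an r-term is $\emptyset$, a term $t$ as above, a filter $\nabla_p(t)$ (the elements of $t$ satisfying $p$, where $p$ is $\ge n$ or $<n$), or an r-term incremented elementwise by $1$; $0$ and $1$ denote $\{0\}$ and $\{1\}$. The configurations are pairs (state, assignment of sets to registers); $I$ is a set of configurations, and a configuration is final if it satisfies the final condition of its state. $A$ is deterministic if $|I|=1$ and every reachable configuration has at most one successor configuration for each letter. $A$ is non-replicating if in no transition a register occurs in two r-terms of one $u(x)$, or in both $u(x)$ and $u(y)$ with $x\neq y$. The size is $|A|=|Q|+\sum_{\delta\in\Delta}|\delta|$, where $|\delta|$ is the number of symbols in the guard and in the update (one symbol per assignment, numerical bounds count nothing). **Simulation.** A set is stored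 as an offset list: an offset $o$ and a sorted doubly linked list $m_1<\dots<m_l$ of integers, representing $\{m_i+o\}$. Incrementing adds $1$ to $o$; filtering deletes elements from the front or from the back one by one; a union $t_1\cup\dots\cup t_n$ is computed by merging $t_1$ with the merge of $t_2,\dots,t_n$, where the list with smaller maximum is inserted into the other by sorted-list merging that starts at the first elements and stops when the inserted list is exhausted; registers are never copied but modified in place; atoms are tested on the least and greatest elements. For each letter the transitions are tried one after the other until one with the right source, letter and satisfied guard is found, and then its update is evaluated. Only numbers stemming from initial singletons $\{n\}$ with $n\ge 2$ are kept apart, in a second, unsorted offset list per register, which is scanned when the register is filtered or when its extremes are recorded, and whose elements are moved one by one at a union; if all initial sets are $\emptyset$, $\{0\}$ or $\{1\}$, this second list is always empty. Time is the number of elementary steps (arithmetic and comparisons of integers, list and pointer operations, visits of nodes of terms and formulas), each of unit cost. **Theorem.** There is a constant $C$ such that the following holds for every deterministic, non-replicating CSA $A$ whose initial configuration $\alpha_0$ assigns to every register a singleton or the empty set, and for every word $w$. The simulation of $A$ on $w$ constructs the run of $A$ on $w$ (it ends with the configuration reached by $A$, or gets stuck iff there is none) and correctly decides whether $w\in L(A)$.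 Processing the letters of $w$ takes at most $C\cdot|A|\cdot|w|$ steps in total; in particular this does not depend on the bounds occurring in the predicates. In addition, setting up $\alpha_0$ takes at most $C\cdot(|X|+1)$ steps, and the final acceptance test takes at most $C\cdot|F(q)|$ steps if the run ends in state $q$ and at most $C$ steps if it is stuck. -/

import Mathlib

universe u v

/-! ## Counting-set automata -/

namespace CountingSet

/-- Atomic predicates on numbers: `x ≥ n` and `x < n`.
(`x > n` is `ge (n + 1)` and `x ≤ n` is `lt (n + 1)`.) -/
inductive Pred where
  | ge (n : ℕ)
  | lt (n : ℕ)

/-- Base semantics of a predicate. -/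
def Pred.Holds : Pred → ℕ → Prop
  | .ge n, e => n ≤ e
  | .lt n, e => e < n

/-- Terms of the counting language over the registers `X`. -/
inductive CTerm (X : Type) where
  | zero
  | one
  | reg (x : X)
  | inc (t : CTerm X)

/-- The `r`-terms: `∅`, terms of the counting language, filters `∇_p(t)` of such terms, and
increments of `r`-terms (so that `∇_p(x) + 1` is included). -/
inductive RTerm (X : Type) where
  | empty
  | base (t : CTerm X)
  | filter (p : Pred) (t : CTerm X)
  | inc (t : RTerm X)

/-- Guards: boolean combinations of atoms `p(t)`. -/
inductive Formula (X : Type) where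
  | tru
  | fls
  | atom (p : Pred) (t : CTerm X)
  | neg (φ : Formula X)
  | conj (φ ψ : Formula X)
  | disj (φ ψ : Formula X)

/-- A memory assigns a set of numbers to every register. -/
abbrev Memory (X : Type) := X → Set ℕ

section Semantics
variable {X : Type}

/-- Value of a counting term under the number-set interpretation. -/
def CTerm.eval (s : Memory X) : CTerm X → Set ℕ
  | .zero => {0}
  | .one => {1}
  | .reg x => s x
  | .inc t => (fun n => n + 1) '' t.eval s

/-- Value of an `r`-term under the number-set interpretation. -/
def RTerm.eval (s : Memory X) : RTerm X → Set ℕ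
  | .empty => ∅
  | .base t => t.eval s
  | .filter p t => {e ∈ t.eval s | p.Holds e}
  | .inc t => (fun n => n + 1) '' t.eval s

/-- Satisfaction of a formula; a set satisfies a predicate iff some element of it does. -/
def Formula.Sat (s : Memory X) : Formula X → Prop
  | .tru => True
  | .fls => False
  | .atom p t => ∃ e ∈ t.eval s, p.Holds e
  | .neg φ => ¬ φ.Sat s
  | .conj φ ψ => φ.Sat s ∧ ψ.Sat s
  | .disj φ ψ => φ.Sat s ∨ ψ.Sat s

/-- Value of the union `t₁ ∪ ⋯ ∪ tₙ`, given as the list of its `r`-terms. -/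
def evalUnion (s : Memory X) (ts : List (RTerm X)) : Set ℕ :=
  {e | ∃ t ∈ ts, e ∈ t.eval s}

/-- The register occurring in a counting term, if any (there is at most one). -/
def CTerm.reg? : CTerm X → Option X
  | .zero => none
  | .one => none
  | .reg x => some x
  | .inc t => t.reg?

/-- The register occurring in an `r`-term, if any (there is at most one). -/
def RTerm.reg? : RTerm X → Option X
  | .empty => none
  | .base t => t.reg?
  | .filter _ t => t.reg?
  | .inc t => t.reg?

/-! Sizes count symbols; a predicate is one symbol, whatever its numerical bound. -/

def CTerm.size : CTerm X → ℕ
  | .zero => 1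
  | .one => 1
  | .reg _ => 1
  | .inc t => t.size + 1

def RTerm.size : RTerm X → ℕ
  | .empty => 1
  | .base t => t.size
  | .filter _ t => t.size + 1
  | .inc t => t.size + 1

def Formula.size : Formula X → ℕ
  | .tru => 1
  | .fls => 1
  | .atom _ t => t.size + 1
  | .neg φ => φ.size + 1
  | .conj φ ψ => φ.size + ψ.size + 1
  | .disj φ ψ => φ.size + ψ.size + 1

end Semantics

/-- A transition `q -{a, φ, u}→ p`; `upd x` lists the `r`-terms of the union assigned to `x`
(the empty list denotes `∅`).  The registers are numbered `0, …, k - 1`. -/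
structure Transition (Q : Type u) (Sg : Type v) (k : ℕ) where
  src : Q
  letter : Sg
  guard : Formula (Fin k)
  upd : Fin k → List (RTerm (Fin k))
  tgt : Q

/-- Size of the guard plus size of the update; an assignment `x := t₁ ∪ ⋯ ∪ tₙ` has the size
of its `r`-terms plus one. -/
def Transition.size {Q : Type u} {Sg : Type v} {k : ℕ} (δ : Transition Q Sg k) : ℕ :=
  δ.guard.size + ∑ x, (1 + ((δ.upd x).map RTerm.size).sum)

/-- Configurations: a state and a memory. -/
abbrev Config (Q : Type u) (k : ℕ) := Q × Memory (Fin k)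

/-- A counting-set automaton. The finite set of transitions is given as a list. -/
structure CSA (Q : Type u) (Sg : Type v) (k : ℕ) where
  trans : List (Transition Q Sg k)
  init : Set (Config Q k)
  final : Q → Formula (Fin k)

namespace CSA
variable {Q : Type u} {Sg : Type v} {k : ℕ}

/-- `|A| = |Q| + ∑ |δ|`. -/
def size [Fintype Q] (A : CSA Q Sg k) : ℕ :=
  Fintype.card Q + (A.trans.map Transition.size).sum

/-- The configuration automaton. -/
def conf (A : CSA Q Sg k) : NFA Sg (Config Q k) where
  step c a := {c' | ∃ δ ∈ A.trans, δ.src = c.1 ∧ δ.letter = a ∧ δ.guard.Sat c.2 ∧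
    c' = (δ.tgt, fun x => evalUnion c.2 (δ.upd x))}
  start := A.init
  accept := {c | (A.final c.1).Sat c.2}

/-- The language of `A` is the language of its configuration automaton. -/
def language (A : CSA Q Sg k) : Language Sg := A.conf.accepts

/-- `A` is deterministic: its configuration automaton, whose states are the reachable
configurations, has one initial state and at most one transition per state and letter. -/
def IsDeterministic (A : CSA Q Sg k) : Prop :=
  (∃ c, A.init = {c}) ∧ ∀ w, ∀ c ∈ A.conf.eval w, ∀ a, (A.conf.step c a).Subsingleton

/-- No register occurs in two `r`-terms of one `u(x)`, nor in both `u(x)` and `u(y)`, `x ≠ y`. -/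
def NonReplicating (A : CSA Q Sg k) : Prop :=
  ∀ δ ∈ A.trans, ∀ z,
    (∀ x, (δ.upd x).countP (fun t => decide (t.reg? = some z)) ≤ 1) ∧
    ∀ x y, x ≠ y → ¬ ((∃ t ∈ δ.upd x, t.reg? = some z) ∧ (∃ t ∈ δ.upd y, t.reg? = some z))

end CSA

/-! ## Offset lists, with running times

An algorithm returns its result together with the number of elementary steps it makes.
An elementary step is one operation on numbers or pointers: arithmetic or comparison of two
integers, access to the first or last element of a doubly linked list, moving to a neighbour,
inserting or deleting at the current position, reading or writing one register slot, comparing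
two states or two letters, visiting one node of a term or formula.  Every bounded bundle of such
operations is charged as one unit; nothing unbounded is free. -/

/-- A result together with the time spent on it. -/
structure Timed (α : Type u) where
  val : α
  time : ℕ

/-- An offset and a list `m₁, …, mₗ`; it represents the numbers `mᵢ + off`. -/
structure OffList where
  off : ℕ
  elems : List ℤ

namespace OffList

/-- The set of numbers that is represented. -/
def toSet (L : OffList) : Set ℕ := {n | ∃ m ∈ L.elems, (n : ℤ) = m + L.off}

def nil : OffList := ⟨0, []⟩

def single (n : ℕ) : OffList := ⟨0, [(n : ℤ)]⟩

/-- Increment of all elements. -/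
def incr (L : OffList) : OffList := ⟨L.off + 1, L.elems⟩

/-- Delete elements from the front as long as they satisfy `p`; one unit per element tested,
or for noticing that the list is exhausted. -/
def trim (p : ℤ → Bool) : List ℤ → Timed (List ℤ)
  | [] => ⟨[], 1⟩
  | m :: l =>
    if p m then
      let r := trim p l
      ⟨r.val, r.time + 1⟩
    else ⟨m :: l, 1⟩

/-- Filter of a sorted offset list: `x ≥ n` deletes from the front, `x < n` from the back.
(Reversal only says that the doubly linked list is traversed from its last element.) -/
def filterSorted : Pred → OffList → Timed OffList
  | .ge n, L =>
    let r := trim (fun m => decide (m + (L.off : ℤ) < (n : ℤ))) L.elems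
    ⟨⟨L.off, r.val⟩, r.time⟩
  | .lt n, L =>
    let r := trim (fun m => decide ((n : ℤ) ≤ m + (L.off : ℤ))) L.elems.reverse
    ⟨⟨L.off, r.val.reverse⟩, r.time⟩

/-- Sorted-list merging: insert the elements `m' + d`, for `m'` in the second list, into the first
list without creating duplicates, by one walk that starts at the first elements and stops when
the second list is exhausted.  One unit per comparison. -/
def insertAll (d : ℤ) : List ℤ → List ℤ → Timed (List ℤ)
  | l, [] => ⟨l, 1⟩
  | [], m' :: l' =>
    let r := insertAll d [] l'
    ⟨(m' + d) :: r.val, r.time + 1⟩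
  | m :: l, m' :: l' =>
    if m < m' + d then
      let r := insertAll d l (m' :: l')
      ⟨m :: r.val, r.time + 1⟩
    else if m = m' + d then
      let r := insertAll d l l'
      ⟨m :: r.val, r.time + 1⟩
    else
      let r := insertAll d (m :: l) l'
      ⟨(m' + d) :: r.val, r.time + 1⟩
  termination_by l l' => l.length + l'.length

/-- Merge the sorted offset list `L'` into the sorted offset list `L`. -/
def mergeInto (L L' : OffList) : Timed OffList :=
  let r := insertAll ((L'.off : ℤ) - (L.off : ℤ)) L.elems L'.elems
  ⟨⟨L.off, r.val⟩, r.time⟩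

/-- Greatest element of a sorted offset list. -/
def max? (L : OffList) : Option ℤ := L.elems.getLast?.map (fun m => m + (L.off : ℤ))

/-- Union of two sorted offset lists: the one with the smaller maximum is merged into the other. -/
def merge (L L' : OffList) : Timed OffList :=
  match L.max?, L'.max? with
  | none, _ => ⟨L', 1⟩
  | some _, none => ⟨L, 1⟩
  | some a, some b =>
    let r := if b ≤ a then mergeInto L L' else mergeInto L' L
    ⟨r.val, r.time + 1⟩

/-- Truth value of a predicate at an integer. -/
def test : Pred → ℤ → Bool
  | .ge n, e => decide ((n : ℤ) ≤ e)
  | .lt n, e => decide (e < (n : ℤ))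

/-- Filter of an unsorted offset list: all elements are tested. -/
def filterAll (p : Pred) (B : OffList) : Timed OffList :=
  ⟨⟨B.off, B.elems.filter (fun m => test p (m + (B.off : ℤ)))⟩, B.elems.length + 1⟩

/-- Union of unsorted offset lists: the elements of `B` are moved one by one into `B'`. -/
def append (B B' : OffList) : Timed OffList :=
  ⟨⟨B'.off, B.elems.map (fun m => m + ((B.off : ℤ) - (B'.off : ℤ))) ++ B'.elems⟩,
    B.elems.length + 1⟩

end OffList

/-- Run-time content of a register: a sorted offset list, and an unsorted one, the `bag`, that only
ever holds numbers stemming from initial singletons `{n}` with `n ≥ 2`. If every initial set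
is `∅`, `{0}` or `{1}`, then all bags stay empty and registers are plain offset lists. -/
structure Reg where
  main : OffList
  bag : OffList

namespace Reg

def toSet (r : Reg) : Set ℕ := r.main.toSet ∪ r.bag.toSet

def nil : Reg := ⟨.nil, .nil⟩

def single (n : ℕ) : Reg := ⟨.single n, .nil⟩

def incr (r : Reg) : Reg := ⟨r.main.incr, r.bag.incr⟩

def filter (p : Pred) (r : Reg) : Timed Reg :=
  let m := r.main.filterSorted p
  let b := r.bag.filterAll p
  ⟨⟨m.val, b.val⟩, m.time + b.time⟩

def merge (r r' : Reg) : Timed Reg :=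
  let m := r.main.merge r'.main
  let b := r.bag.append r'.bag
  ⟨⟨m.val, b.val⟩, m.time + b.time⟩

/-- `merge(r₁, merge(r₂, … merge(rₙ₋₁, rₙ)…))`. -/
def mergeAll : List Reg → Timed Reg
  | [] => ⟨.nil, 1⟩
  | [r] => ⟨r, 1⟩
  | r :: r' :: rs =>
    let t := mergeAll (r' :: rs)
    let m := r.merge t.val
    ⟨m.val, t.time + m.time + 1⟩

/-- Extend a pair (least, greatest) by a number. -/
def extend (e : Option (ℤ × ℤ)) (n : ℤ) : Option (ℤ × ℤ) :=
  match e with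
  | none => some (n, n)
  | some (lo, hi) => some (min lo n, max hi n)

/-- Least and greatest element: first and last element of the sorted list, compared with all
elements of the bag. -/
def ends (r : Reg) : Timed (Option (ℤ × ℤ)) :=
  let e := match r.main.elems.head?, r.main.elems.getLast? with
    | some a, some b => some (a + (r.main.off : ℤ), b + (r.main.off : ℤ))
    | _, _ => none
  ⟨r.bag.elems.foldl (fun e m => extend e (m + (r.bag.off : ℤ))) e, r.bag.elems.length + 1⟩

/-- Initial content of a register holding `∅` or `{n}`. -/
def ofInit : Option ℕ → Reg
  | none => .nil
  | some n => if n ≤ 1 then .single n else ⟨.nil, .single n⟩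

end Reg

/-! ## Evaluation of updates, in situ -/

/-- Content of all registers. -/
abbrev File (k : ℕ) := Fin k → Reg

section Eval
variable {k : ℕ}

/-- Evaluate a counting term. The offset lists of a register that is read are not copied: they
are taken out of the file and modified in place. -/
def CTerm.run (f : File k) : CTerm (Fin k) → Timed (Reg × File k)
  | .zero => ⟨(.single 0, f), 1⟩
  | .one => ⟨(.single 1, f), 1⟩
  | .reg x => ⟨(f x, Function.update f x .nil), 1⟩
  | .inc t =>
    let r := t.run f
    ⟨(r.val.1.incr, r.val.2), r.time + 1⟩

def RTerm.run (f : File k) : RTerm (Fin k) → Timed (Reg × File k)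
  | .empty => ⟨(.nil, f), 1⟩
  | .base t => t.run f
  | .filter p t =>
    let r := t.run f
    let s := r.val.1.filter p
    ⟨(s.val, r.val.2), r.time + s.time⟩
  | .inc t =>
    let r := t.run f
    ⟨(r.val.1.incr, r.val.2), r.time + 1⟩

/-- Evaluate a list of `r`-terms one after the other. -/
def runTerms (f : File k) : List (RTerm (Fin k)) → Timed (List Reg × File k)
  | [] => ⟨([], f), 1⟩
  | t :: ts =>
    let r := t.run f
    let rs := runTerms r.val.2 ts
    ⟨(r.val.1 :: rs.val.1, rs.val.2), r.time + rs.time + 1⟩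

/-- The new file, and the recorded least and greatest element of every register. -/
abbrev Table (k : ℕ) := File k × (Fin k → Option (ℤ × ℤ))

/-- Write `r` into the slot of `x` and record its ends. -/
def assign (T : Table k) (x : Fin k) (r : Reg) : Timed (Table k) :=
  let e := r.ends
  ⟨(Function.update T.1 x r, Function.update T.2 x e.val), e.time + 1⟩

/-- For every register `x` in the list: evaluate the `r`-terms of `u(x)`, unite the results and
assign the union to `x`. `f` holds the old file, `T` collects the new one. -/
def runAssignments (u : Fin k → List (RTerm (Fin k))) :
    List (Fin k) → File k → Table k → Timed (Table k)
  | [], _, T => ⟨T, 1⟩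
  | x :: xs, f, T =>
    let ts := runTerms f (u x)
    let r := Reg.mergeAll ts.val.1
    let T' := assign T x r.val
    let rest := runAssignments u xs ts.val.2 T'.val
    ⟨rest.val, ts.time + r.time + T'.time + rest.time + 1⟩

/-- Evaluate an update; allocating the new table is charged one unit per slot. -/
def runUpdate (u : Fin k → List (RTerm (Fin k))) (f : File k) : Timed (Table k) :=
  let r := runAssignments u (List.finRange k) f (fun _ => .nil, fun _ => none)
  ⟨r.val, r.time + k + 1⟩

/-! ## Evaluation of guards, from the recorded ends -/

/-- Least and greatest element of the value of a counting term. -/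
def CTerm.runEnds (e : Fin k → Option (ℤ × ℤ)) : CTerm (Fin k) → Timed (Option (ℤ × ℤ))
  | .zero => ⟨some (0, 0), 1⟩
  | .one => ⟨some (1, 1), 1⟩
  | .reg x => ⟨e x, 1⟩
  | .inc t =>
    let r := t.runEnds e
    ⟨r.val.map (fun b => (b.1 + 1, b.2 + 1)), r.time + 1⟩

/-- `x ≥ n` is tested on the greatest element, `x < n` on the least one. -/
def Pred.testEnds : Pred → Option (ℤ × ℤ) → Bool
  | _, none => false
  | .ge n, some b => decide ((n : ℤ) ≤ b.2)
  | .lt n, some b => decide (b.1 < (n : ℤ))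

def Formula.run (e : Fin k → Option (ℤ × ℤ)) : Formula (Fin k) → Timed Bool
  | .tru => ⟨true, 1⟩
  | .fls => ⟨false, 1⟩
  | .atom p t =>
    let r := t.runEnds e
    ⟨p.testEnds r.val, r.time + 1⟩
  | .neg φ =>
    let r := φ.run e
    ⟨!r.val, r.time + 1⟩
  | .conj φ ψ =>
    let r := φ.run e
    let s := ψ.run e
    ⟨r.val && s.val, r.time + s.time + 1⟩
  | .disj φ ψ =>
    let r := φ.run e
    let s := ψ.run e
    ⟨r.val || s.val, r.time + s.time + 1⟩

end Eval

/-! ## The simulation -/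

/-- What the simulation stores: the current state and the table of the registers. -/
structure SimState (Q : Type u) (k : ℕ) where
  state : Q
  table : Table k

/-- The configuration that is represented. -/
def SimState.toConfig {Q : Type u} {k : ℕ} (σ : SimState Q k) : Config Q k :=
  (σ.state, fun x => (σ.table.1 x).toSet)

/-- Go through the transitions until one is found that leaves `q`, reads `a` and whose guard
is satisfied. -/
def findTrans {Q : Type u} {Sg : Type v} {k : ℕ} [DecidableEq Q] [DecidableEq Sg]
    (q : Q) (a : Sg) (e : Fin k → Option (ℤ × ℤ)) :
    List (Transition Q Sg k) → Timed (Option (Transition Q Sg k))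
  | [] => ⟨none, 1⟩
  | δ :: Δ =>
    if δ.src = q ∧ δ.letter = a then
      let g := δ.guard.run e
      if g.val then ⟨some δ, g.time + 1⟩
      else
        let r := findTrans q a e Δ
        ⟨r.val, g.time + r.time + 1⟩
    else
      let r := findTrans q a e Δ
      ⟨r.val, r.time + 1⟩

open scoped Classical in
/-- The number in a singleton set, `none` for the empty set. -/
noncomputable def initValue (S : Set ℕ) : Option ℕ := if S.Nonempty then some (sInf S) else none

/-- Write the initial contents of the registers in the list. -/
def initTable {k : ℕ} (v : Fin k → Option ℕ) : List (Fin k) → Table k → Timed (Table k)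
  | [], T => ⟨T, 1⟩
  | x :: xs, T =>
    let T' := assign T x (Reg.ofInit (v x))
    let r := initTable v xs T'.val
    ⟨r.val, T'.time + r.time + 1⟩

/-- Set up the representation of an initial configuration. -/
noncomputable def simInit {Q : Type u} {k : ℕ} (α₀ : Config Q k) : Timed (SimState Q k) :=
  let r := initTable (fun x => initValue (α₀.2 x)) (List.finRange k) (fun _ => .nil, fun _ => none)
  ⟨⟨α₀.1, r.val⟩, r.time + k + 1⟩

namespace CSA
variable {Q : Type u} {Sg : Type v} {k : ℕ} [DecidableEq Q] [DecidableEq Sg]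

/-- Process one letter; `none` if no transition is enabled. -/
def simStep (A : CSA Q Sg k) (a : Sg) (σ : SimState Q k) : Timed (Option (SimState Q k)) :=
  let t := findTrans σ.state a σ.table.2 A.trans
  match t.val with
  | none => ⟨none, t.time + 1⟩
  | some δ =>
    let r := runUpdate δ.upd σ.table.1
    ⟨some ⟨δ.tgt, r.val⟩, t.time + r.time + 1⟩

/-- Process the letters of a word; `none` if the run gets stuck. -/
def simLoop (A : CSA Q Sg k) : List Sg → SimState Q k → Timed (Option (SimState Q k))
  | [], σ => ⟨some σ, 0⟩
  | a :: w, σ =>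
    let r := A.simStep a σ
    match r.val with
    | none => ⟨none, r.time⟩
    | some σ' =>
      let s := A.simLoop w σ'
      ⟨s.val, r.time + s.time⟩

/-- The part of the simulation that constructs the run on `w`. -/
noncomputable def simRun (A : CSA Q Sg k) (α₀ : Config Q k) (w : List Sg) :
    Timed (Option (SimState Q k)) :=
  A.simLoop w (simInit α₀).val

/-- Test whether the run ends in a final configuration. -/
def simAccept (A : CSA Q Sg k) : Option (SimState Q k) → Timed Bool
  | none => ⟨false, 1⟩
  | some σ =>
    let r := (A.final σ.state).run σ.table.2
    ⟨r.val, r.time + 1⟩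

end CSA

end CountingSet

/-! The running time is amortized. A sorted offset list carries as potential its length plus its
height, the height being the maximum plus one, or zero if the list is empty. A filter spends one
unit of length per deleted element. Merging stops once the list with smaller maximum is exhausted.
Each comparison passes at least one natural number up to that maximum, so the walk is paid by the
smaller height, which disappears because the union only keeps the larger one (`time_insertAll`,
`time_mergeInto`). An increment raises the height by one, and the constants `0` and `1` bring
bounded potential. Hence an update costs, up to the drop of total potential, a multiple of its
number of symbols. No bound of a predicate enters.

An initial singleton `{n}` would bring potential about `n`. Large ones therefore live in the bags,
without potential. Registers are moved and never copied, so the bags together never hold more than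
`k` elements. Each of these is touched at most three times per update: by a filter, by a union, and
when the ends are recorded. Any transition that fires has size at least `k`, which absorbs this cost
and the initial potential.

For correctness, non-replication says that every register is read at most once per update, so taking
it out of the file destroys nothing that is needed later. A guard atom depends only on the least or
the greatest element of a set (`IsEnds.testEnds`). Determinism makes the first enabled transition
found yield the only successor of a reachable configuration (`evalFrom_eq_simLoop`). -/

namespace CountingSet

/-! ### Offset lists: correctness and amortized cost. -/

namespace OffList

/-- The list is strictly sorted and represents natural numbers. -/
structure Valid (L : OffList) : Prop where
  sorted : L.elems.Pairwise (· < ·)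
  nonneg : ∀ m ∈ L.elems, 0 ≤ m + (L.off : ℤ)

/-- One more than the greatest number represented, and `0` for the empty list. -/
def height (L : OffList) : ℕ := L.elems.toFinset.sup fun m => (m + (L.off : ℤ) + 1).toNat

/-- The potential of a sorted offset list. -/
def weight (L : OffList) : ℕ := L.elems.length + L.height

theorem height_le_iff {L : OffList} {N : ℕ} :
    L.height ≤ N ↔ ∀ m ∈ L.elems, m + (L.off : ℤ) < N := by
  simp only [height, Finset.sup_le_iff, List.mem_toFinset]
  exact forall₂_congr fun m _ => by omega

theorem lt_height {L : OffList} {m : ℤ} (hm : m ∈ L.elems) : m + (L.off : ℤ) < L.height :=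
  height_le_iff.1 le_rfl m hm

theorem mem_toSet {L : OffList} {n : ℕ} : n ∈ L.toSet ↔ ∃ m ∈ L.elems, (n : ℤ) = m + L.off :=
  Iff.rfl

@[simp] theorem toSet_nil : OffList.nil.toSet = ∅ := by
  ext n; simp [mem_toSet, nil]

@[simp] theorem toSet_single (n : ℕ) : (single n).toSet = {n} := by
  ext m; simp [mem_toSet, single]

/-- Without nonnegativity, an entry standing for `-1` is invisible in `toSet` but would surface as
`0` after the increment. -/
theorem toSet_incr {L : OffList} (h : ∀ m ∈ L.elems, 0 ≤ m + (L.off : ℤ)) :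
    L.incr.toSet = (fun n => n + 1) '' L.toSet := by
  ext n
  simp only [mem_toSet, incr, Set.mem_image]
  constructor
  · rintro ⟨m, hm, e⟩
    have := h m hm
    push_cast at e
    exact ⟨(m + L.off).toNat, ⟨m, hm, by omega⟩, by omega⟩
  · rintro ⟨n', ⟨m, hm, e⟩, rfl⟩
    exact ⟨m, hm, by push_cast; omega⟩

theorem nonneg_incr {L : OffList} (h : ∀ m ∈ L.elems, 0 ≤ m + (L.off : ℤ)) :
    ∀ m ∈ L.incr.elems, 0 ≤ m + (L.incr.off : ℤ) := by
  intro m hm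
  have := h m hm
  simp only [incr]
  push_cast
  omega

theorem valid_nil : OffList.nil.Valid := ⟨by simp [nil], by simp [nil]⟩

theorem valid_single (n : ℕ) : (single n).Valid := ⟨by simp [single], by simp [single]⟩

theorem Valid.incr {L : OffList} (h : L.Valid) : L.incr.Valid := ⟨h.sorted, nonneg_incr h.nonneg⟩

@[simp] theorem weight_nil : OffList.nil.weight = 0 := by simp [weight, nil, height]

/-- Harmless for `n ≤ 1`. The growth with `n` is why large initial singletons are kept in bags. -/
theorem weight_single (n : ℕ) : (single n).weight = n + 2 := by
  simp [weight, single, height]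
  omega

theorem weight_incr_le (L : OffList) : L.incr.weight ≤ L.weight + 1 := by
  have : L.incr.height ≤ L.height + 1 := height_le_iff.2 fun m hm => by
    have := lt_height (L := L) hm
    simp only [OffList.incr]
    push_cast
    omega
  simp only [weight, OffList.incr] at *
  omega

theorem trim_suffix (p : ℤ → Bool) (l : List ℤ) : (trim p l).val <:+ l := by
  induction l with
  | nil => simp [trim]
  | cons m l ih =>
    rw [trim]
    split
    · exact ih.trans (List.suffix_cons m l)
    · exact List.suffix_rfl

/-- Each unit but the last deletes an element, so the lost length pays for it. -/
theorem time_trim (p : ℤ → Bool) (l : List ℤ) :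
    (trim p l).time + (trim p l).val.length ≤ l.length + 1 := by
  induction l with
  | nil => simp [trim]
  | cons m l ih =>
    rw [trim]
    split
    · simp only [List.length_cons]; omega
    · simp only [List.length_cons]; omega

/-- Since `p` is inherited by earlier elements, the elements satisfying it form a prefix. The order
`r` is a parameter so that the reversed list, sorted by `>`, is covered too. -/
theorem mem_trim {r : ℤ → ℤ → Prop} {p : ℤ → Bool} (hp : ∀ a b, r a b → p b → p a) {l : List ℤ}
    (hl : l.Pairwise r) {m : ℤ} : m ∈ (trim p l).val ↔ m ∈ l ∧ p m = false := by
  induction l with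
  | nil => simp [trim]
  | cons a l ih =>
    rw [List.pairwise_cons] at hl
    rw [trim]
    split
    · rename_i h
      simp only [ih hl.2, List.mem_cons]
      constructor
      · rintro ⟨h1, h2⟩; exact ⟨.inr h1, h2⟩
      · rintro ⟨rfl | h1, h2⟩
        · simp [h] at h2
        · exact ⟨h1, h2⟩
    · rename_i h
      simp only [List.mem_cons, iff_self_and]
      rintro (rfl | h1)
      · simpa using h
      · by_contra h2
        exact h (hp a m (hl.1 m h1) (by simpa using h2))

theorem filterSorted_off (p : Pred) (L : OffList) : (L.filterSorted p).val.off = L.off := by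
  cases p <;> rfl

theorem filterSorted_sublist (p : Pred) (L : OffList) :
    (L.filterSorted p).val.elems.Sublist L.elems := by
  cases p with
  | ge n => exact (trim_suffix _ _).sublist
  | lt n =>
    have := (trim_suffix (fun m => decide ((n : ℤ) ≤ m + (L.off : ℤ))) L.elems.reverse).sublist
    simpa [filterSorted] using this.reverse

theorem mem_filterSorted (p : Pred) {L : OffList} (h : L.Valid) {m : ℤ} :
    m ∈ (L.filterSorted p).val.elems ↔ m ∈ L.elems ∧ test p (m + L.off) = true := by
  cases p with
  | ge n =>
    refine (mem_trim (r := (· < ·)) ?_ h.sorted).trans ?_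
    · simp only [decide_eq_true_eq]; intros; omega
    · simp [test]
  | lt n =>
    simp only [filterSorted, List.mem_reverse]
    refine (mem_trim (r := fun a b => b < a) ?_ (List.pairwise_reverse.2 h.sorted)).trans ?_
    · simp only [decide_eq_true_eq]; intros; omega
    · simp [test]

theorem test_natCast (p : Pred) (n : ℕ) : test p n = true ↔ p.Holds n := by
  cases p <;> simp [test, Pred.Holds]

theorem Valid.filterSorted {L : OffList} (h : L.Valid) (p : Pred) :
    (L.filterSorted p).val.Valid :=
  ⟨h.sorted.sublist (filterSorted_sublist p L), fun m hm => by
    rw [filterSorted_off]; exact h.nonneg m ((filterSorted_sublist p L).subset hm)⟩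

theorem toSet_filterSorted {L : OffList} (h : L.Valid) (p : Pred) :
    (L.filterSorted p).val.toSet = {e ∈ L.toSet | p.Holds e} := by
  ext n
  simp only [mem_toSet, Set.mem_ofPred_eq, mem_filterSorted p h, filterSorted_off]
  constructor
  · rintro ⟨m, ⟨hm, ht⟩, e⟩
    exact ⟨⟨m, hm, e⟩, (test_natCast p n).1 (e ▸ ht)⟩
  · rintro ⟨⟨m, hm, e⟩, hn⟩
    exact ⟨m, ⟨hm, e ▸ (test_natCast p n).2 hn⟩, e⟩

theorem time_filterSorted (p : Pred) (L : OffList) :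
    (L.filterSorted p).time + (L.filterSorted p).val.weight ≤ L.weight + 1 := by
  have h1 : (L.filterSorted p).val.height ≤ L.height := height_le_iff.2 fun m hm => by
    rw [filterSorted_off]; exact lt_height ((filterSorted_sublist p L).subset hm)
  have h2 : (L.filterSorted p).time + (L.filterSorted p).val.elems.length
      ≤ L.elems.length + 1 := by
    cases p with
    | ge n => exact time_trim _ _
    | lt n =>
      have := time_trim (fun m => decide ((n : ℤ) ≤ m + (L.off : ℤ))) L.elems.reverse
      simpa [filterSorted] using this
  simp only [weight]
  omega

theorem mem_insertAll (d : ℤ) (l l' : List ℤ) {m : ℤ} :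
    m ∈ (insertAll d l l').val ↔ m ∈ l ∨ ∃ m' ∈ l', m = m' + d := by
  fun_induction insertAll d l l' with
  | case1 l => simp
  | case2 m' l' r ih => simp only [r, List.mem_cons, ih]; simp
  | case3 a l m' l' h r ih => simp only [r, List.mem_cons, ih]; simp [or_assoc]
  | case4 l m' l' r h ih =>
    simp only [r, List.mem_cons, ih, exists_eq_or_imp]; tauto
  | case5 a l m' l' h h' r ih => simp only [r, List.mem_cons, ih, exists_eq_or_imp]; tauto

theorem length_insertAll (d : ℤ) (l l' : List ℤ) :
    (insertAll d l l').val.length ≤ l.length + l'.length := by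
  fun_induction insertAll d l l' with
  | case1 l => simp
  | case2 m' l' r ih => simp only [r, List.length_cons] at *; omega
  | case3 a l m' l' h r ih => simp only [r, List.length_cons] at *; omega
  | case4 l m' l' r h ih => simp only [r, List.length_cons] at *; omega
  | case5 a l m' l' h h' r ih => simp only [r, List.length_cons] at *; omega

theorem sorted_insertAll (d : ℤ) (l l' : List ℤ) (hl : l.Pairwise (· < ·))
    (hl' : l'.Pairwise (· < ·)) : (insertAll d l l').val.Pairwise (· < ·) := by
  fun_induction insertAll d l l' with
  | case1 l => exact hl
  | case2 m' l' r ih =>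
    rw [List.pairwise_cons] at hl'
    refine List.pairwise_cons.2 ⟨fun b hb => ?_, ih hl hl'.2⟩
    obtain hb | ⟨c, hc, rfl⟩ := (mem_insertAll d _ _).1 hb
    · simp at hb
    · have := hl'.1 c hc; omega
  | case3 a l m' l' h r ih =>
    rw [List.pairwise_cons] at hl
    refine List.pairwise_cons.2 ⟨fun b hb => ?_, ih hl.2 hl'⟩
    obtain hb | ⟨c, hc, rfl⟩ := (mem_insertAll d _ _).1 hb
    · exact hl.1 b hb
    · obtain rfl | hc := List.mem_cons.1 hc
      · exact h
      · have := (List.pairwise_cons.1 hl').1 c hc; omega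
  | case4 l m' l' r h ih =>
    rw [List.pairwise_cons] at hl hl'
    refine List.pairwise_cons.2 ⟨fun b hb => ?_, ih hl.2 hl'.2⟩
    obtain hb | ⟨c, hc, rfl⟩ := (mem_insertAll d _ _).1 hb
    · exact hl.1 b hb
    · have := hl'.1 c hc; omega
  | case5 a l m' l' h h' r ih =>
    rw [List.pairwise_cons] at hl'
    refine List.pairwise_cons.2 ⟨fun b hb => ?_, ih hl hl'.2⟩
    obtain hb | ⟨c, hc, rfl⟩ := (mem_insertAll d _ _).1 hb
    · obtain rfl | hb := List.mem_cons.1 hb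
      · omega
      · have := (List.pairwise_cons.1 hl).1 b hb; omega
    · have := hl'.1 c hc; omega

/-- Both remaining lists stay above `c`. Each comparison consumes the smaller head, so by strict
sorting `c` can be raised by one. As long as something is left to insert, `c < N`. -/
theorem time_insertAll (d : ℤ) (l l' : List ℤ) (hl : l.Pairwise (· < ·))
    (hl' : l'.Pairwise (· < ·)) (c N : ℤ) (h1 : ∀ m ∈ l, c ≤ m) (h2 : ∀ m ∈ l', c ≤ m + d)
    (h3 : ∀ m ∈ l', m + d < N) : (insertAll d l l').time ≤ (N - c).toNat + 1 := by
  fun_induction insertAll d l l' generalizing c with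
  | case1 l => simp
  | case2 m' l' r ih =>
    rw [List.pairwise_cons] at hl'
    have hN := h3 m' (by simp)
    have hc := h2 m' (by simp)
    have := ih hl hl'.2 (c + 1) (by simp) (fun m hm => by have := hl'.1 m hm; omega)
      (fun m hm => h3 m (by simp [hm]))
    simp only [r]; omega
  | case3 a l m' l' h r ih =>
    rw [List.pairwise_cons] at hl
    have hN := h3 m' (by simp)
    have hc := h1 a (by simp)
    have := ih hl.2 hl' (c + 1) (fun m hm => by have := hl.1 m hm; omega)
      (fun m hm => by
        obtain rfl | hm := List.mem_cons.1 hm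
        · omega
        · have := (List.pairwise_cons.1 hl').1 m hm; omega) h3
    simp only [r]; omega
  | case4 l m' l' r h ih =>
    rw [List.pairwise_cons] at hl hl'
    have hN := h3 m' (by simp)
    have hc := h2 m' (by simp)
    have := ih hl.2 hl'.2 (c + 1) (fun m hm => by have := hl.1 m hm; omega)
      (fun m hm => by have := hl'.1 m hm; omega) (fun m hm => h3 m (by simp [hm]))
    simp only [r]; omega
  | case5 a l m' l' h h' r ih =>
    rw [List.pairwise_cons] at hl'
    have hN := h3 m' (by simp)
    have hc := h2 m' (by simp)
    have := ih hl hl'.2 (c + 1) (fun m hm => by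
        obtain rfl | hm := List.mem_cons.1 hm
        · omega
        · have := (List.pairwise_cons.1 hl).1 m hm; omega)
      (fun m hm => by have := hl'.1 m hm; omega) (fun m hm => h3 m (by simp [hm]))
    simp only [r]; omega

theorem Valid.mergeInto {L L' : OffList} (h : L.Valid) (h' : L'.Valid) :
    (L.mergeInto L').val.Valid := by
  refine ⟨sorted_insertAll _ _ _ h.sorted h'.sorted, fun m hm => ?_⟩
  obtain hm | ⟨c, hc, rfl⟩ := (mem_insertAll _ _ _).1 hm
  · exact h.nonneg m hm
  · have := h'.nonneg c hc
    simp only [OffList.mergeInto]; omega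

theorem toSet_mergeInto (L L' : OffList) :
    (L.mergeInto L').val.toSet = L.toSet ∪ L'.toSet := by
  ext n
  simp only [mem_toSet, Set.mem_union, mergeInto, mem_insertAll]
  constructor
  · rintro ⟨m, hm | ⟨c, hc, rfl⟩, e⟩
    · exact .inl ⟨m, hm, e⟩
    · exact .inr ⟨c, hc, by omega⟩
  · rintro (⟨m, hm, e⟩ | ⟨c, hc, e⟩)
    · exact ⟨m, .inl hm, e⟩
    · exact ⟨_, .inr ⟨c, hc, rfl⟩, by omega⟩

/-- The walk costs at most the height of `L'` plus one, and that height is released: the union is no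
higher than `L`. Lengths at most add up. -/
theorem time_mergeInto {L L' : OffList} (h : L.Valid) (h' : L'.Valid)
    (hh : L'.height ≤ L.height) :
    (L.mergeInto L').time + (L.mergeInto L').val.weight ≤ L.weight + L'.weight + 1 := by
  have h1 : (L.mergeInto L').val.height ≤ L.height := height_le_iff.2 fun m hm => by
    obtain hm | ⟨c, hc, rfl⟩ := (mem_insertAll _ _ _).1 hm
    · exact lt_height hm
    · have := lt_height hc
      simp only [OffList.mergeInto]; omega
  have h2 := length_insertAll ((L'.off : ℤ) - (L.off : ℤ)) L.elems L'.elems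
  -- In the coordinates of `L`, the number `0` is `-L.off`, so the window from `c` to `N` has length
  -- exactly `L'.height`.
  have h3 := time_insertAll ((L'.off : ℤ) - (L.off : ℤ)) L.elems L'.elems h.sorted h'.sorted
    (-L.off) (L'.height - L.off) (fun m hm => by have := h.nonneg m hm; omega)
    (fun m hm => by have := h'.nonneg m hm; omega)
    (fun m hm => by have := lt_height hm; omega)
  simp only [weight, OffList.mergeInto] at *
  omega

theorem max?_eq_none {L : OffList} : L.max? = none ↔ L.elems = [] := by
  simp [max?]

/-- Turns the comparison of last elements made by `merge` into the comparison of heights needed by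
`time_mergeInto`. -/
theorem height_of_max? {L : OffList} (h : L.Valid) {a : ℤ} (ha : L.max? = some a) :
    (L.height : ℤ) = a + 1 := by
  simp only [max?, Option.map_eq_some_iff] at ha
  obtain ⟨m, hm, rfl⟩ := ha
  obtain ⟨l, hl⟩ := List.getLast?_eq_some_iff.1 hm
  have hmem : m ∈ L.elems := by simp [hl]
  have h1 := lt_height hmem
  have h2 := h.nonneg m hmem
  have h3 : L.height ≤ (m + L.off + 1).toNat := height_le_iff.2 fun b hb => by
    have hs := h.sorted
    rw [hl, List.pairwise_append] at hs
    rw [hl, List.mem_append] at hb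
    obtain hb | hb := hb
    · have := hs.2.2 b hb m (by simp); omega
    · simp at hb; omega
  omega

theorem toSet_of_elems_eq_nil {L : OffList} (h : L.elems = []) : L.toSet = ∅ := by
  ext n; simp [mem_toSet, h]

theorem Valid.merge {L L' : OffList} (h : L.Valid) (h' : L'.Valid) : (L.merge L').val.Valid := by
  unfold OffList.merge
  split
  · exact h'
  · exact h
  · dsimp only
    split
    · exact h.mergeInto h'
    · exact h'.mergeInto h

theorem toSet_merge (L L' : OffList) : (L.merge L').val.toSet = L.toSet ∪ L'.toSet := by
  unfold merge
  split
  · rename_i h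
    simp [toSet_of_elems_eq_nil (max?_eq_none.1 h)]
  · rename_i h
    simp [toSet_of_elems_eq_nil (max?_eq_none.1 h)]
  · dsimp only
    split
    · exact toSet_mergeInto L L'
    · exact (toSet_mergeInto L' L).trans (Set.union_comm _ _)

theorem time_merge {L L' : OffList} (h : L.Valid) (h' : L'.Valid) :
    (L.merge L').time + (L.merge L').val.weight ≤ L.weight + L'.weight + 2 := by
  unfold merge
  split
  · dsimp only; omega
  · dsimp only; omega
  · rename_i a b ha hb
    have := height_of_max? h ha
    have := height_of_max? h' hb
    dsimp only
    split
    · have := time_mergeInto h h' (by omega); omega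
    · have := time_mergeInto h' h (by omega); omega

theorem toSet_filterAll (p : Pred) (B : OffList) :
    (B.filterAll p).val.toSet = {e ∈ B.toSet | p.Holds e} := by
  ext n
  simp only [mem_toSet, Set.mem_ofPred_eq, filterAll, List.mem_filter]
  constructor
  · rintro ⟨m, ⟨hm, ht⟩, e⟩
    exact ⟨⟨m, hm, e⟩, (test_natCast p n).1 (e ▸ ht)⟩
  · rintro ⟨⟨m, hm, e⟩, hn⟩
    exact ⟨m, ⟨hm, e ▸ (test_natCast p n).2 hn⟩, e⟩

theorem toSet_append (B B' : OffList) : (B.append B').val.toSet = B.toSet ∪ B'.toSet := by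
  ext n
  simp only [mem_toSet, Set.mem_union, append, List.mem_append, List.mem_map]
  constructor
  · rintro ⟨_, ⟨c, hc, rfl⟩ | hm, e⟩
    · exact .inl ⟨c, hc, by omega⟩
    · exact .inr ⟨_, hm, e⟩
  · rintro (⟨c, hc, e⟩ | ⟨c, hc, e⟩)
    · exact ⟨_, .inl ⟨c, hc, rfl⟩, by omega⟩
    · exact ⟨c, .inr hc, e⟩

end OffList

/-! ### Registers: a sorted list together with a bag. -/

namespace Reg

/-- Both lists represent natural numbers, and the main one is sorted. -/
structure Valid (r : Reg) : Prop where
  main : r.main.Valid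
  bag : ∀ m ∈ r.bag.elems, 0 ≤ m + (r.bag.off : ℤ)

/-- Number of elements of the bag. -/
def bagSize (r : Reg) : ℕ := r.bag.elems.length

theorem valid_nil : Reg.nil.Valid := ⟨OffList.valid_nil, by simp [nil, OffList.nil]⟩

theorem valid_single (n : ℕ) : (Reg.single n).Valid :=
  ⟨OffList.valid_single n, by simp [single, OffList.nil]⟩

theorem Valid.incr {r : Reg} (h : r.Valid) : r.incr.Valid :=
  ⟨h.main.incr, OffList.nonneg_incr h.bag⟩

theorem Valid.filter {r : Reg} (h : r.Valid) (p : Pred) : (r.filter p).val.Valid :=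
  ⟨h.main.filterSorted p, fun m hm => h.bag m (List.mem_filter.1 hm).1⟩

theorem Valid.merge {r r' : Reg} (h : r.Valid) (h' : r'.Valid) : (r.merge r').val.Valid := by
  refine ⟨h.main.merge h'.main, fun m hm => ?_⟩
  simp only [Reg.merge, OffList.append, List.mem_append, List.mem_map] at hm ⊢
  obtain ⟨c, hc, rfl⟩ | hm := hm
  · have := h.bag c hc; omega
  · exact h'.bag m hm

theorem Valid.mergeAll {rs : List Reg} (h : ∀ r ∈ rs, r.Valid) : (Reg.mergeAll rs).val.Valid := by
  fun_induction Reg.mergeAll rs with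
  | case1 => exact valid_nil
  | case2 r => exact h r (by simp)
  | case3 r r' rs t m ih => exact (h r (by simp)).merge (ih fun s hs => h s (by simp_all))

@[simp] theorem toSet_nil : Reg.nil.toSet = ∅ := by simp [toSet, nil]

@[simp] theorem toSet_single (n : ℕ) : (Reg.single n).toSet = {n} := by simp [toSet, single]

theorem toSet_incr {r : Reg} (h : r.Valid) : r.incr.toSet = (fun n => n + 1) '' r.toSet := by
  simp only [toSet, incr, OffList.toSet_incr h.main.nonneg, OffList.toSet_incr h.bag,
    Set.image_union]

theorem toSet_filter {r : Reg} (h : r.Valid) (p : Pred) :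
    (r.filter p).val.toSet = {e ∈ r.toSet | p.Holds e} := by
  simp only [toSet, filter, OffList.toSet_filterSorted h.main, OffList.toSet_filterAll]
  ext n
  simp only [Set.mem_union, Set.mem_ofPred_eq]
  tauto

theorem toSet_merge (r r' : Reg) : (r.merge r').val.toSet = r.toSet ∪ r'.toSet := by
  simp only [toSet, merge, OffList.toSet_merge, OffList.toSet_append]
  exact Set.union_union_union_comm _ _ _ _

theorem mem_toSet_mergeAll (rs : List Reg) {n : ℕ} :
    n ∈ (Reg.mergeAll rs).val.toSet ↔ ∃ r ∈ rs, n ∈ r.toSet := by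
  fun_induction Reg.mergeAll rs with
  | case1 => simp
  | case2 r => simp
  | case3 r r' rs t m ih => simp only [m, t, toSet_merge, Set.mem_union, ih]; simp

@[simp] theorem bagSize_nil : Reg.nil.bagSize = 0 := by simp [bagSize, nil, OffList.nil]

@[simp] theorem bagSize_single (n : ℕ) : (Reg.single n).bagSize = 0 := by
  simp [bagSize, single, OffList.nil]

@[simp] theorem bagSize_incr (r : Reg) : r.incr.bagSize = r.bagSize := rfl

theorem bagSize_filter_le (r : Reg) (p : Pred) : (r.filter p).val.bagSize ≤ r.bagSize :=
  List.length_filter_le _ _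

theorem bagSize_merge (r r' : Reg) : (r.merge r').val.bagSize = r.bagSize + r'.bagSize := by
  simp [bagSize, merge, OffList.append]

theorem bagSize_mergeAll (rs : List Reg) :
    (Reg.mergeAll rs).val.bagSize = (rs.map bagSize).sum := by
  fun_induction Reg.mergeAll rs with
  | case1 => simp
  | case2 r => simp
  | case3 r r' rs t m ih => simp only [m, t, bagSize_merge, ih]; simp

theorem time_filter (r : Reg) (p : Pred) :
    (r.filter p).time + (r.filter p).val.main.weight ≤ r.main.weight + r.bagSize + 2 := by
  have := OffList.time_filterSorted p r.main
  simp only [filter, OffList.filterAll, bagSize]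
  omega

theorem time_merge {r r' : Reg} (h : r.Valid) (h' : r'.Valid) :
    (r.merge r').time + (r.merge r').val.main.weight
      ≤ r.main.weight + r'.main.weight + r.bagSize + 3 := by
  have := OffList.time_merge h.main h'.main
  simp only [merge, OffList.append, bagSize]
  omega

/-- Each bag is moved once into the accumulated one, which is not traversed, so every bag is charged
only once. -/
theorem time_mergeAll {rs : List Reg} (h : ∀ r ∈ rs, r.Valid) :
    (Reg.mergeAll rs).time + (Reg.mergeAll rs).val.main.weight
      ≤ (rs.map fun r => r.main.weight + r.bagSize + 4).sum + 1 := by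
  fun_induction Reg.mergeAll rs with
  | case1 => simp [nil]
  | case2 r => simp; omega
  | case3 r r' rs t m ih =>
    have h1 : ∀ s ∈ r' :: rs, s.Valid := fun s hs => h s (by simp_all)
    have h2 := ih h1
    have h3 := time_merge (h r (by simp)) (Valid.mergeAll h1)
    simp only [List.map_cons, List.sum_cons, m, t] at *
    omega

theorem time_ends (r : Reg) : r.ends.time = r.bagSize + 1 := rfl

end Reg

/-! ### Least and greatest elements. -/

/-- `e` consists of the least and the greatest element of `S`, and is `none` if `S` is empty. -/
def IsEnds (S : Set ℕ) (e : Option (ℤ × ℤ)) : Prop :=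
  (S = ∅ ∧ e = none) ∨ ∃ a b : ℕ, IsLeast S a ∧ IsGreatest S b ∧ e = some ((a : ℤ), (b : ℤ))

theorem IsEnds.extend {S : Set ℕ} {e : Option (ℤ × ℤ)} (h : IsEnds S e) (n : ℕ) :
    IsEnds (insert n S) (Reg.extend e n) := by
  obtain ⟨rfl, rfl⟩ | ⟨a, b, ha, hb, rfl⟩ := h
  · exact .inr ⟨n, n, by simp, by simp, rfl⟩
  · refine .inr ⟨min n a, max n b, ha.insert n, hb.insert n, ?_⟩
    simp [Reg.extend, min_comm, max_comm]

theorem IsEnds.foldl_extend {o : ℕ} {l : List ℤ} (hl : ∀ m ∈ l, 0 ≤ m + (o : ℤ)) {S : Set ℕ}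
    {e : Option (ℤ × ℤ)} (h : IsEnds S e) :
    IsEnds (S ∪ OffList.toSet ⟨o, l⟩) (l.foldl (fun e m => Reg.extend e (m + (o : ℤ))) e) := by
  induction l generalizing S e with
  | nil => simpa [OffList.toSet] using h
  | cons m l ih =>
    have hm := hl m (by simp)
    have h1 := ih (fun m hm => hl m (by simp [hm])) (h.extend (m + o).toNat)
    rw [Int.toNat_of_nonneg hm] at h1
    have h2 : S ∪ OffList.toSet ⟨o, m :: l⟩
        = insert (m + o).toNat S ∪ OffList.toSet ⟨o, l⟩ := by
      ext n
      simp only [Set.mem_union, Set.mem_insert_iff, OffList.mem_toSet, List.mem_cons,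
        exists_eq_or_imp]
      have : (n : ℤ) = m + o ↔ n = (m + (o : ℤ)).toNat := by omega
      rw [this]
      tauto
    rw [h2]
    exact h1

theorem OffList.Valid.isEnds {L : OffList} (h : L.Valid) :
    IsEnds L.toSet (match L.elems.head?, L.elems.getLast? with
      | some a, some b => some (a + (L.off : ℤ), b + (L.off : ℤ))
      | _, _ => none) := by
  split
  · rename_i a b ha hb
    obtain ⟨l, hl⟩ := List.head?_eq_some_iff.1 ha
    obtain ⟨l', hl'⟩ := List.getLast?_eq_some_iff.1 hb
    have ha' : a ∈ L.elems := by simp [hl]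
    have hb' : b ∈ L.elems := by simp [hl']
    have ha0 := h.nonneg a ha'
    have hb0 := h.nonneg b hb'
    refine .inr ⟨(a + L.off).toNat, (b + L.off).toNat, ⟨⟨a, ha', by omega⟩, ?_⟩,
      ⟨⟨b, hb', by omega⟩, ?_⟩, by simp [ha0, hb0]⟩
    · rintro n ⟨m, hm, e⟩
      have hs := h.sorted
      rw [hl, List.pairwise_cons] at hs
      rw [hl] at hm
      obtain rfl | hm := List.mem_cons.1 hm
      · omega
      · have := hs.1 m hm; omega
    · rintro n ⟨m, hm, e⟩
      have hs := h.sorted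
      rw [hl', List.pairwise_append] at hs
      rw [hl', List.mem_append] at hm
      obtain hm | hm := hm
      · have := hs.2.2 m hm b (by simp); omega
      · simp at hm; omega
  · rename_i hx
    left
    refine ⟨OffList.toSet_of_elems_eq_nil ?_, rfl⟩
    by_contra hne
    exact hx _ _ (List.head?_eq_some_head hne) (List.getLast?_eq_some_getLast hne)

theorem Reg.Valid.isEnds {r : Reg} (h : r.Valid) : IsEnds r.toSet r.ends.val :=
  h.main.isEnds.foldl_extend h.bag

/-! ### Evaluation of terms in situ. -/

section Eval
variable {k : ℕ}

/-- Take the register `o`, if any, out of the file. -/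
def File.clear (f : File k) (o : Option (Fin k)) : File k :=
  o.elim f fun x => Function.update f x .nil

/-- All registers of the file are valid. -/
def File.Valid (f : File k) : Prop := ∀ x, (f x).Valid

/-- The sets stored in the file. -/
def File.toMemory (f : File k) : Memory (Fin k) := fun x => (f x).toSet

/-- Total potential of the sorted lists. -/
def File.weight (f : File k) : ℕ := ∑ x, (f x).main.weight

/-- Total number of elements of the bags. -/
def File.bagSize (f : File k) : ℕ := ∑ x, (f x).bagSize

theorem File.clear_of_ne (f : File k) {o : Option (Fin k)} {z : Fin k} (h : o ≠ some z) :
    f.clear o z = f z := by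
  cases o with
  | none => rfl
  | some x =>
    have : z ≠ x := fun e => h (e ▸ rfl)
    simp [clear, this]

theorem Reg.Valid.update {f : File k} (hf : f.Valid) {r : Reg} (hr : r.Valid) (x : Fin k) :
    File.Valid (Function.update f x r) := by
  intro z
  by_cases h : z = x
  · subst h; simpa using hr
  · simpa [h] using hf z

theorem File.Valid.clear {f : File k} (hf : f.Valid) (o : Option (Fin k)) : (f.clear o).Valid := by
  cases o with
  | none => exact hf
  | some x => exact Reg.valid_nil.update hf x

/-- Balance of potential when a slot is overwritten, with both sides additive to avoid truncated
subtraction. -/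
theorem sum_comp_update_add {α : Type} (w : α → ℕ) (f : Fin k → α) (x : Fin k) (r : α) :
    ∑ z, w (Function.update f x r z) + w (f x) = ∑ z, w (f z) + w r := by
  rw [← Finset.add_sum_erase _ _ (Finset.mem_univ x),
    ← Finset.add_sum_erase _ (fun z => w (f z)) (Finset.mem_univ x)]
  have : ∑ z ∈ Finset.univ.erase x, w (Function.update f x r z)
      = ∑ z ∈ Finset.univ.erase x, w (f z) :=
    Finset.sum_congr rfl fun z hz => by simp [Finset.ne_of_mem_erase hz]
  simp only [this, Function.update_self]
  omega

theorem File.weight_update (f : File k) (x : Fin k) (r : Reg) :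
    File.weight (Function.update f x r) + (f x).main.weight = f.weight + r.main.weight :=
  sum_comp_update_add (fun r : Reg => r.main.weight) f x r

theorem File.bagSize_update (f : File k) (x : Fin k) (r : Reg) :
    File.bagSize (Function.update f x r) + (f x).bagSize = f.bagSize + r.bagSize :=
  sum_comp_update_add Reg.bagSize f x r

theorem CTerm.run_file (f : File k) (t : CTerm (Fin k)) : (t.run f).val.2 = f.clear t.reg? := by
  induction t with
  | zero => rfl
  | one => rfl
  | reg x => rfl
  | inc t ih => exact ih

theorem RTerm.run_file (f : File k) (t : RTerm (Fin k)) : (t.run f).val.2 = f.clear t.reg? := by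
  induction t with
  | empty => rfl
  | base t => exact t.run_file f
  | filter p t => exact t.run_file f
  | inc t ih => exact ih

theorem CTerm.valid_run {f : File k} (hf : f.Valid) (t : CTerm (Fin k)) :
    (t.run f).val.1.Valid := by
  induction t with
  | zero => exact Reg.valid_single 0
  | one => exact Reg.valid_single 1
  | reg x => exact hf x
  | inc t ih => exact ih.incr

theorem RTerm.valid_run {f : File k} (hf : f.Valid) (t : RTerm (Fin k)) :
    (t.run f).val.1.Valid := by
  induction t with
  | empty => exact Reg.valid_nil
  | base t => exact t.valid_run hf
  | filter p t => exact (t.valid_run hf).filter p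
  | inc t ih => exact ih.incr

theorem CTerm.toSet_run {f : File k} (hf : f.Valid) (t : CTerm (Fin k)) :
    (t.run f).val.1.toSet = t.eval f.toMemory := by
  induction t with
  | zero => exact Reg.toSet_single 0
  | one => exact Reg.toSet_single 1
  | reg x => rfl
  | inc t ih =>
    simp only [CTerm.run, CTerm.eval, ← ih]
    exact Reg.toSet_incr (t.valid_run hf)

theorem RTerm.toSet_run {f : File k} (hf : f.Valid) (t : RTerm (Fin k)) :
    (t.run f).val.1.toSet = t.eval f.toMemory := by
  induction t with
  | empty => exact Reg.toSet_nil
  | base t => exact t.toSet_run hf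
  | filter p t =>
    simp only [RTerm.run, RTerm.eval, ← t.toSet_run hf]
    exact Reg.toSet_filter (t.valid_run hf) p
  | inc t ih =>
    simp only [RTerm.run, RTerm.eval, ← ih]
    exact Reg.toSet_incr (t.valid_run hf)

theorem CTerm.eval_congr {X : Type} {s s' : Memory X} (t : CTerm X)
    (h : ∀ x, t.reg? = some x → s x = s' x) : t.eval s = t.eval s' := by
  induction t with
  | zero => rfl
  | one => rfl
  | reg x => exact h x rfl
  | inc t ih => simp only [eval, ih h]

theorem RTerm.eval_congr {X : Type} {s s' : Memory X} (t : RTerm X)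
    (h : ∀ x, t.reg? = some x → s x = s' x) : t.eval s = t.eval s' := by
  induction t with
  | empty => rfl
  | base t => exact t.eval_congr h
  | filter p t => simp only [eval, t.eval_congr h]
  | inc t ih => simp only [eval, ih h]

theorem evalUnion_congr {X : Type} {s s' : Memory X} {ts : List (RTerm X)}
    (h : ∀ x ∈ ts.filterMap RTerm.reg?, s x = s' x) : evalUnion s ts = evalUnion s' ts := by
  ext n
  simp only [evalUnion, Set.mem_ofPred_eq]
  refine exists_congr fun t => and_congr_right fun ht => ?_
  rw [t.eval_congr fun x hx => h x (List.mem_filterMap.2 ⟨t, ht, hx⟩)]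

/-- Reading a register empties its slot, so bag elements move from the file to the result and never
multiply. -/
theorem CTerm.bagSize_run (f : File k) (t : CTerm (Fin k)) :
    (t.run f).val.1.bagSize + (t.run f).val.2.bagSize ≤ f.bagSize := by
  induction t with
  | zero => simp [run]
  | one => simp [run]
  | reg x =>
    have := f.bagSize_update x .nil
    simp only [Reg.bagSize_nil] at this
    simp only [run]
    omega
  | inc t ih => exact ih

theorem RTerm.bagSize_run (f : File k) (t : RTerm (Fin k)) :
    (t.run f).val.1.bagSize + (t.run f).val.2.bagSize ≤ f.bagSize := by
  induction t with
  | empty => simp [run]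
  | base t => exact t.bagSize_run f
  | filter p t =>
    have h1 := t.bagSize_run f
    have h2 := (t.run f).val.1.bagSize_filter_le p
    simp only [run]
    omega
  | inc t ih => exact ih

/-- The factor `4` is attained by the constant `1`: one step plus potential `3`. Reading a register
transfers its potential. -/
theorem CTerm.time_run (f : File k) (t : CTerm (Fin k)) :
    (t.run f).time + (t.run f).val.1.main.weight + (t.run f).val.2.weight
      ≤ f.weight + 4 * t.size := by
  induction t with
  | zero =>
    have := OffList.weight_single 0
    simp only [run, Reg.single, size]
    omega
  | one =>
    have := OffList.weight_single 1
    simp only [run, Reg.single, size]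
    omega
  | reg x =>
    have := f.weight_update x .nil
    have h : Reg.nil.main.weight = 0 := OffList.weight_nil
    simp only [run, size]
    omega
  | inc t ih =>
    have := OffList.weight_incr_le (t.run f).val.1.main
    simp only [run, Reg.incr, size]
    omega

/-- Of the two units per bag element in the file, one pays for the scan by a filter, of which there
is at most one in an `r`-term. The other stays with the result, to pay for the union. -/
theorem RTerm.time_run (f : File k) (t : RTerm (Fin k)) :
    (t.run f).time + (t.run f).val.1.main.weight + (t.run f).val.1.bagSize
      + ((t.run f).val.2.weight + 2 * (t.run f).val.2.bagSize)
      ≤ f.weight + 2 * f.bagSize + 4 * t.size := by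
  induction t with
  | empty =>
    have h : Reg.nil.main.weight = 0 := OffList.weight_nil
    simp only [run, size, Reg.bagSize_nil]
    omega
  | base t =>
    have h1 := t.bagSize_run f
    have h2 := t.time_run f
    simp only [run, size]
    omega
  | filter p t =>
    have h1 := t.bagSize_run f
    have h2 := t.time_run f
    have h3 := (t.run f).val.1.bagSize_filter_le p
    have h4 := (t.run f).val.1.time_filter p
    simp only [run, size]
    omega
  | inc t ih =>
    have := OffList.weight_incr_le (t.run f).val.1.main
    simp only [run, size, Reg.bagSize_incr]
    simp only [Reg.incr]
    omega

theorem RTerm.one_le_size {X : Type} (t : RTerm X) : 1 ≤ t.size := by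
  have h : ∀ c : CTerm X, 1 ≤ c.size := fun c => by cases c <;> simp [CTerm.size]
  cases t with
  | base t => exact h t
  | _ => simp [size]

theorem runTerms_file (ts : List (RTerm (Fin k))) (f : File k) {z : Fin k}
    (hz : z ∉ ts.filterMap RTerm.reg?) : (runTerms f ts).val.2 z = f z := by
  induction ts generalizing f with
  | nil => rfl
  | cons t ts ih =>
    simp only [List.mem_filterMap, List.mem_cons, exists_eq_or_imp, not_or] at hz ih
    simp only [runTerms]
    rw [ih _ hz.2, t.run_file, f.clear_of_ne hz.1]

theorem valid_runTerms (ts : List (RTerm (Fin k))) {f : File k} (hf : f.Valid) :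
    (∀ r ∈ (runTerms f ts).val.1, r.Valid) ∧ (runTerms f ts).val.2.Valid := by
  induction ts generalizing f with
  | nil => exact ⟨by simp [runTerms], hf⟩
  | cons t ts ih =>
    have h1 : (t.run f).val.2.Valid := by rw [t.run_file]; exact hf.clear _
    refine ⟨?_, (ih h1).2⟩
    simp only [runTerms, List.mem_cons, forall_eq_or_imp]
    exact ⟨t.valid_run hf, (ih h1).1⟩

theorem mem_runTerms (ts : List (RTerm (Fin k))) {f : File k} (hf : f.Valid)
    (hts : (ts.filterMap RTerm.reg?).Nodup) {n : ℕ} :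
    (∃ r ∈ (runTerms f ts).val.1, n ∈ r.toSet) ↔ n ∈ evalUnion f.toMemory ts := by
  induction ts generalizing f with
  | nil => simp [runTerms, evalUnion]
  | cons t ts ih =>
    have h1 : (t.run f).val.2.Valid := by rw [t.run_file]; exact hf.clear _
    have h2 : (ts.filterMap RTerm.reg?).Nodup := by
      rw [List.filterMap_cons] at hts
      split at hts
      · exact hts
      · exact (List.nodup_cons.1 hts).2
    have h3 : evalUnion (t.run f).val.2.toMemory ts = evalUnion f.toMemory ts := by
      refine evalUnion_congr fun x hx => ?_
      rw [t.run_file, File.toMemory, File.toMemory, f.clear_of_ne]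
      -- If `t` read `x`, then `x` would occur again in `ts`, against `hts`.
      intro e
      rw [List.filterMap_cons, e] at hts
      exact (List.nodup_cons.1 hts).1 hx
    simp only [runTerms, List.mem_cons, exists_eq_or_imp]
    rw [ih h1 h2, h3, t.toSet_run hf]
    simp [evalUnion]

theorem bagSize_runTerms (ts : List (RTerm (Fin k))) (f : File k) :
    ((runTerms f ts).val.1.map Reg.bagSize).sum + (runTerms f ts).val.2.bagSize
      ≤ f.bagSize := by
  induction ts generalizing f with
  | nil => simp [runTerms]
  | cons t ts ih =>
    have h1 := t.bagSize_run f
    have h2 := ih (t.run f).val.2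
    simp only [runTerms, List.map_cons, List.sum_cons]
    omega

/-- The left-hand sum is what `Reg.time_mergeAll` will spend. Per term there are `4 * t.size` units,
`4` for its merge and `1` for the list, at most `9 * t.size`. -/
theorem time_runTerms (ts : List (RTerm (Fin k))) (f : File k) :
    (runTerms f ts).time
      + ((runTerms f ts).val.1.map fun r => r.main.weight + r.bagSize + 4).sum
      + ((runTerms f ts).val.2.weight + 2 * (runTerms f ts).val.2.bagSize)
      ≤ f.weight + 2 * f.bagSize + 9 * (ts.map RTerm.size).sum + 1 := by
  induction ts generalizing f with
  | nil => simp [runTerms]; omega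
  | cons t ts ih =>
    have h1 := t.time_run f
    have h2 := ih (t.run f).val.2
    have h3 := t.one_le_size
    simp only [runTerms, List.map_cons, List.sum_cons]
    omega

/-- The table holds valid registers and their least and greatest elements. -/
structure TableValid (T : Table k) : Prop where
  file : File.Valid T.1
  ends : ∀ x, IsEnds (T.1 x).toSet (T.2 x)

theorem tableValid_empty : TableValid ((fun _ => .nil, fun _ => none) : Table k) :=
  ⟨fun _ => Reg.valid_nil, fun _ => .inl ⟨Reg.toSet_nil, rfl⟩⟩

theorem TableValid.assign {T : Table k} (hT : TableValid T) (x : Fin k) {r : Reg}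
    (hr : r.Valid) : TableValid (assign T x r).val := by
  refine ⟨hr.update hT.file x, fun z => ?_⟩
  simp only [CountingSet.assign]
  by_cases h : z = x
  · subst h; simpa using hr.isEnds
  · simpa [h] using hT.ends z

/-! ### Evaluation of a whole update. -/

section Assignments
variable (u : Fin k → List (RTerm (Fin k)))

theorem TableValid.runAssignments (xs : List (Fin k)) {f : File k} (hf : f.Valid) {T : Table k}
    (hT : TableValid T) : TableValid (runAssignments u xs f T).val := by
  induction xs generalizing f T with
  | nil => exact hT
  | cons x xs ih =>
    have h := valid_runTerms (u x) hf
    exact ih h.2 (hT.assign x (Reg.Valid.mergeAll h.1))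

theorem runAssignments_of_notMem (xs : List (Fin k)) (f : File k) (T : Table k) {z : Fin k}
    (hz : z ∉ xs) : (runAssignments u xs f T).val.1 z = T.1 z := by
  induction xs generalizing f T with
  | nil => rfl
  | cons x xs ih =>
    simp only [List.mem_cons, not_or] at hz
    simp only [runAssignments]
    rw [ih _ _ hz.2]
    simp [assign, hz.1]

/-- By `hu`, no register read for an earlier assignment is needed by a later one. The slots emptied
meanwhile therefore do not affect the later values. -/
theorem toSet_runAssignments (xs : List (Fin k)) {f : File k} (hf : f.Valid) (T : Table k)
    (hxs : xs.Nodup) (hu : (xs.flatMap fun x => (u x).filterMap RTerm.reg?).Nodup)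
    {z : Fin k} (hz : z ∈ xs) :
    ((runAssignments u xs f T).val.1 z).toSet = evalUnion f.toMemory (u z) := by
  induction xs generalizing f T with
  | nil => simp at hz
  | cons x xs ih =>
    rw [List.nodup_cons] at hxs
    rw [List.flatMap_cons, List.nodup_append'] at hu
    simp only [runAssignments]
    by_cases h : z = x
    · subst h
      rw [runAssignments_of_notMem _ _ _ _ hxs.1]
      ext n
      simp only [assign, Function.update_self]
      rw [Reg.mem_toSet_mergeAll, mem_runTerms _ hf hu.1]
    · have hz' : z ∈ xs := (List.mem_cons.1 hz).resolve_left h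
      rw [ih (valid_runTerms (u x) hf).2 _ hxs.2 hu.2.1 hz']
      refine evalUnion_congr fun y hy => ?_
      rw [File.toMemory, File.toMemory, runTerms_file]
      exact fun hy' => hu.2.2 hy' (List.mem_flatMap.2 ⟨z, hz', hy⟩)

theorem bagSize_runAssignments (xs : List (Fin k)) (f : File k) (T : Table k) :
    File.bagSize (runAssignments u xs f T).val.1 ≤ File.bagSize T.1 + f.bagSize := by
  induction xs generalizing f T with
  | nil => simp [runAssignments]
  | cons x xs ih =>
    have h1 := bagSize_runTerms (u x) f
    have h2 := Reg.bagSize_mergeAll (runTerms f (u x)).val.1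
    have h3 := ih (runTerms f (u x)).val.2
      (assign T x (Reg.mergeAll (runTerms f (u x)).val.1).val).val
    have h4 := File.bagSize_update T.1 x (Reg.mergeAll (runTerms f (u x)).val.1).val
    simp only [runAssignments]
    simp only [assign] at *
    omega

/-- The third unit per bag element pays for recording the ends. After that the element lies in the
new table and is not charged again in this update. -/
theorem time_runAssignments (xs : List (Fin k)) {f : File k} (hf : f.Valid) (T : Table k) :
    (runAssignments u xs f T).time + File.weight (runAssignments u xs f T).val.1
      ≤ File.weight T.1 + f.weight + 3 * f.bagSize
        + (xs.map fun x => 9 * (1 + ((u x).map RTerm.size).sum)).sum + 1 := by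
  induction xs generalizing f T with
  | nil => simp only [runAssignments, List.map_nil, List.sum_nil]; omega
  | cons x xs ih =>
    have h0 := valid_runTerms (u x) hf
    have h1 := bagSize_runTerms (u x) f
    have h2 := Reg.bagSize_mergeAll (runTerms f (u x)).val.1
    have h3 := ih h0.2 (assign T x (Reg.mergeAll (runTerms f (u x)).val.1).val).val
    have h4 := File.weight_update T.1 x (Reg.mergeAll (runTerms f (u x)).val.1).val
    have h5 := time_runTerms (u x) f
    have h6 := Reg.time_mergeAll h0.1
    have h7 := Reg.time_ends (Reg.mergeAll (runTerms f (u x)).val.1).val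
    simp only [runAssignments, List.map_cons, List.sum_cons]
    simp only [assign] at *
    omega

theorem TableValid.runUpdate {f : File k} (hf : f.Valid) : TableValid (runUpdate u f).val :=
  tableValid_empty.runAssignments u _ hf

theorem toSet_runUpdate {f : File k} (hf : f.Valid)
    (hu : ((List.finRange k).flatMap fun x => (u x).filterMap RTerm.reg?).Nodup) (z : Fin k) :
    ((runUpdate u f).val.1 z).toSet = evalUnion f.toMemory (u z) :=
  toSet_runAssignments u _ hf _ (List.nodup_finRange k) hu (List.mem_finRange z)

theorem bagSize_runUpdate (f : File k) : File.bagSize (runUpdate u f).val.1 ≤ f.bagSize := by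
  have := bagSize_runAssignments u (List.finRange k) f (fun _ => .nil, fun _ => none)
  simpa [File.bagSize, runUpdate] using this

theorem time_runUpdate {f : File k} (hf : f.Valid) :
    (runUpdate u f).time + File.weight (runUpdate u f).val.1
      ≤ f.weight + 3 * f.bagSize + 9 * ∑ x, (1 + ((u x).map RTerm.size).sum) + k + 2 := by
  have h := time_runAssignments u (List.finRange k) hf (fun _ => .nil, fun _ => none)
  have h1 : File.weight (fun _ : Fin k => Reg.nil) = 0 :=
    Finset.sum_eq_zero fun _ _ => OffList.weight_nil
  have h2 : ((List.finRange k).map fun x => 9 * (1 + ((u x).map RTerm.size).sum)).sum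
      = 9 * ∑ x, (1 + ((u x).map RTerm.size).sum) := by
    rw [Finset.mul_sum, ← List.ofFn_eq_map, List.sum_ofFn]
  simp only [runUpdate]
  dsimp only at h
  omega

end Assignments

/-! ### Guards and the search for a transition. -/

theorem IsEnds.testEnds {S : Set ℕ} {e : Option (ℤ × ℤ)} (h : IsEnds S e) (p : Pred) :
    p.testEnds e = true ↔ ∃ n ∈ S, p.Holds n := by
  obtain ⟨rfl, rfl⟩ | ⟨a, b, ha, hb, rfl⟩ := h
  · cases p <;> simp [Pred.testEnds]
  · cases p with
    | ge n =>
      simp only [Pred.testEnds, Pred.Holds, decide_eq_true_eq, Nat.cast_le]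
      exact ⟨fun h => ⟨b, hb.1, h⟩, fun ⟨m, hm, h⟩ => h.trans (hb.2 hm)⟩
    | lt n =>
      simp only [Pred.testEnds, Pred.Holds, decide_eq_true_eq, Nat.cast_lt]
      exact ⟨fun h => ⟨a, ha.1, h⟩, fun ⟨m, hm, h⟩ => (ha.2 hm).trans_lt h⟩

theorem IsEnds.incr {S : Set ℕ} {e : Option (ℤ × ℤ)} (h : IsEnds S e) :
    IsEnds ((fun n => n + 1) '' S) (e.map fun b => (b.1 + 1, b.2 + 1)) := by
  have hm : Monotone fun n : ℕ => n + 1 := fun _ _ h => Nat.succ_le_succ h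
  obtain ⟨rfl, rfl⟩ | ⟨a, b, ha, hb, rfl⟩ := h
  · exact .inl ⟨Set.image_empty _, rfl⟩
  · exact .inr ⟨a + 1, b + 1, hm.map_isLeast ha, hm.map_isGreatest hb, by simp⟩

variable {s : Memory (Fin k)} {e : Fin k → Option (ℤ × ℤ)}

theorem CTerm.isEnds_runEnds (h : ∀ x, IsEnds (s x) (e x)) (t : CTerm (Fin k)) :
    IsEnds (t.eval s) (t.runEnds e).val := by
  induction t with
  | zero => exact .inr ⟨0, 0, by simp [eval], by simp [eval], by simp [runEnds]⟩
  | one => exact .inr ⟨1, 1, by simp [eval], by simp [eval], by simp [runEnds]⟩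
  | reg x => exact h x
  | inc t ih => exact ih.incr

theorem Formula.run_eq_true (h : ∀ x, IsEnds (s x) (e x)) (φ : Formula (Fin k)) :
    (φ.run e).val = true ↔ φ.Sat s := by
  induction φ with
  | tru => simp [run, Sat]
  | fls => simp [run, Sat]
  | atom p t => exact (t.isEnds_runEnds h).testEnds p
  | neg φ ih => simp [run, Sat, ← ih]
  | conj φ ψ ih ih' => simp [run, Sat, ← ih, ← ih']
  | disj φ ψ ih ih' => simp [run, Sat, ← ih, ← ih']

theorem CTerm.time_runEnds (t : CTerm (Fin k)) : (t.runEnds e).time = t.size := by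
  induction t with
  | inc t ih => simp [runEnds, size, ih]
  | _ => rfl

theorem Formula.time_run (φ : Formula (Fin k)) : (φ.run e).time = φ.size := by
  induction φ with
  | atom p t => simp [run, size, t.time_runEnds]
  | neg φ ih => simp [run, size, ih]
  | conj φ ψ ih ih' => simp [run, size, ih, ih']
  | disj φ ψ ih ih' => simp [run, size, ih, ih']
  | _ => rfl

end Eval

section FindTrans
variable {Q : Type u} {Sg : Type v} {k : ℕ} [DecidableEq Q] [DecidableEq Sg]

theorem findTrans_eq_some {q : Q} {a : Sg} {e : Fin k → Option (ℤ × ℤ)}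
    {Δ : List (Transition Q Sg k)} {δ : Transition Q Sg k}
    (h : (findTrans q a e Δ).val = some δ) :
    δ ∈ Δ ∧ δ.src = q ∧ δ.letter = a ∧ (δ.guard.run e).val = true := by
  induction Δ with
  | nil => simp [findTrans] at h
  | cons δ' Δ ih =>
    simp only [findTrans] at h
    split at h
    · rename_i h1
      split at h
      · rename_i h2
        obtain rfl : δ' = δ := by simpa using h
        exact ⟨by simp, h1.1, h1.2, h2⟩
      · exact (ih h).imp_left (List.mem_cons_of_mem _)
    · exact (ih h).imp_left (List.mem_cons_of_mem _)

theorem findTrans_eq_none {q : Q} {a : Sg} {e : Fin k → Option (ℤ × ℤ)}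
    {Δ : List (Transition Q Sg k)} (h : (findTrans q a e Δ).val = none) :
    ∀ δ ∈ Δ, δ.src = q → δ.letter = a → (δ.guard.run e).val = false := by
  induction Δ with
  | nil => simp
  | cons δ' Δ ih =>
    simp only [findTrans] at h
    simp only [List.mem_cons, forall_eq_or_imp]
    split at h
    · split at h
      · simp at h
      · rename_i h2
        exact ⟨fun _ _ => by simpa using h2, ih h⟩
    · rename_i h1
      exact ⟨fun h2 h3 => absurd ⟨h2, h3⟩ h1, ih h⟩

theorem Formula.one_le_size {X : Type} (φ : Formula X) : 1 ≤ φ.size := by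
  cases φ <;> simp [size]

/-- A transition costs at most its guard plus one, and a guard has at least one symbol, whence the
factor `2`. -/
theorem time_findTrans (q : Q) (a : Sg) (e : Fin k → Option (ℤ × ℤ))
    (Δ : List (Transition Q Sg k)) :
    (findTrans q a e Δ).time ≤ 2 * (Δ.map Transition.size).sum + 1 := by
  induction Δ with
  | nil => simp [findTrans]
  | cons δ Δ ih =>
    have h1 := δ.guard.one_le_size
    have h2 := δ.guard.time_run (e := e)
    have h3 : δ.guard.size ≤ δ.size := Nat.le_add_right _ _
    simp only [findTrans, List.map_cons, List.sum_cons]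
    split
    · split <;> dsimp only <;> omega
    · dsimp only; omega

end FindTrans

theorem isEnds_toMemory {k : ℕ} {T : Table k} (hT : TableValid T) (x : Fin k) :
    IsEnds (File.toMemory T.1 x) (T.2 x) :=
  hT.ends x

/-- Every assignment counts at least one symbol. Costs linear in the number of registers are thus
covered as soon as some transition exists. -/
theorem Transition.le_size {Q : Type u} {Sg : Type v} {k : ℕ} (δ : Transition Q Sg k) :
    k ≤ δ.size := by
  have : k ≤ ∑ x, (1 + ((δ.upd x).map RTerm.size).sum) := by
    rw [Finset.sum_add_distrib]; simp
  exact this.trans (Nat.le_add_left _ _)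

/-! ### The initial configuration. -/

section Init
variable {k : ℕ}

theorem Reg.valid_ofInit (o : Option ℕ) : (Reg.ofInit o).Valid := by
  cases o with
  | none => exact valid_nil
  | some n =>
    simp only [ofInit]
    split
    · exact valid_single n
    · exact ⟨OffList.valid_nil, (OffList.valid_single n).nonneg⟩

theorem Reg.toSet_ofInit_initValue {S : Set ℕ} (hS : S = ∅ ∨ ∃ n, S = {n}) :
    (Reg.ofInit (initValue S)).toSet = S := by
  obtain rfl | ⟨n, rfl⟩ := hS
  · simp [initValue, ofInit]
  · have : initValue {n} = some n := by simp [initValue]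
    rw [this, ofInit]
    split
    · exact toSet_single n
    · simp [toSet]

/-- Independent of the initial number: anything above `1` goes to the bag. -/
theorem Reg.weight_ofInit (o : Option ℕ) : (Reg.ofInit o).main.weight ≤ 3 := by
  cases o with
  | none => simp [ofInit, nil]
  | some n =>
    simp only [ofInit]
    split
    · simp only [single, OffList.weight_single]; omega
    · simp

theorem Reg.bagSize_ofInit (o : Option ℕ) : (Reg.ofInit o).bagSize ≤ 1 := by
  cases o with
  | none => simp [ofInit]
  | some n =>
    simp only [ofInit]
    split
    · simp
    · simp [bagSize, OffList.single]

variable (v : Fin k → Option ℕ)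

theorem TableValid.initTable (xs : List (Fin k)) {T : Table k} (hT : TableValid T) :
    TableValid (initTable v xs T).val := by
  induction xs generalizing T with
  | nil => exact hT
  | cons x xs ih => exact ih (hT.assign x (Reg.valid_ofInit _))

theorem initTable_file (xs : List (Fin k)) (T : Table k) (z : Fin k) :
    (initTable v xs T).val.1 z = if z ∈ xs then Reg.ofInit (v z) else T.1 z := by
  induction xs generalizing T with
  | nil => simp [initTable]
  | cons x xs ih =>
    simp only [initTable, ih, assign, List.mem_cons]
    by_cases h : z ∈ xs
    · simp [h]
    · by_cases h' : z = x
      · subst h'; simp [h]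
      · simp [h, h']

theorem time_initTable (xs : List (Fin k)) (T : Table k) :
    (initTable v xs T).time ≤ 4 * xs.length + 1 := by
  induction xs generalizing T with
  | nil => simp [initTable]
  | cons x xs ih =>
    have h1 := Reg.bagSize_ofInit (v x)
    have h2 := Reg.time_ends (Reg.ofInit (v x))
    have h3 := ih (assign T x (Reg.ofInit (v x))).val
    simp only [initTable, List.length_cons]
    simp only [assign] at *
    omega

variable {Q : Type u} (α₀ : Config Q k)

theorem tableValid_simInit : TableValid (simInit α₀).val.table :=
  tableValid_empty.initTable _ _

theorem simInit_file (x : Fin k) :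
    (simInit α₀).val.table.1 x = Reg.ofInit (initValue (α₀.2 x)) := by
  simp [simInit, initTable_file]

theorem toConfig_simInit (h : ∀ x, α₀.2 x = ∅ ∨ ∃ n, α₀.2 x = {n}) :
    (simInit α₀).val.toConfig = α₀ := by
  refine Prod.ext rfl (funext fun x => ?_)
  simp only [SimState.toConfig, simInit_file]
  exact Reg.toSet_ofInit_initValue (h x)

theorem weight_simInit : File.weight (simInit α₀).val.table.1 ≤ 3 * k := by
  have : File.weight (simInit α₀).val.table.1 ≤ ∑ _x : Fin k, 3 :=
    Finset.sum_le_sum fun x _ => by rw [simInit_file]; exact Reg.weight_ofInit _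
  simpa [mul_comm] using this

theorem bagSize_simInit : File.bagSize (simInit α₀).val.table.1 ≤ k := by
  have : File.bagSize (simInit α₀).val.table.1 ≤ ∑ _x : Fin k, 1 :=
    Finset.sum_le_sum fun x _ => by rw [simInit_file]; exact Reg.bagSize_ofInit _
  simpa using this

theorem time_simInit : (simInit α₀).time ≤ 5 * (k + 1) := by
  have := time_initTable (fun x => initValue (α₀.2 x)) (List.finRange k)
    (fun _ => .nil, fun _ => none)
  simp only [simInit]
  simp only [List.length_finRange] at this
  omega

end Init

/-! ### The run: correctness and total time. -/

namespace CSA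
variable {Q : Type u} {Sg : Type v} {k : ℕ} {A : CSA Q Sg k}

/-- Both clauses of non-replication in one: the first gives no repetition within a union, the second
disjointness of different unions. -/
theorem NonReplicating.nodup (hA : A.NonReplicating) {δ : Transition Q Sg k} (hδ : δ ∈ A.trans) :
    ((List.finRange k).flatMap fun x => (δ.upd x).filterMap RTerm.reg?).Nodup := by
  refine List.nodup_flatMap.2 ⟨fun x _ => List.nodup_iff_count_le_one.2 fun z => ?_,
    (List.nodup_finRange k).imp fun {x y} hxy => ?_⟩
  · rw [List.count_filterMap]
    refine le_of_eq_of_le (List.countP_congr fun t _ => ?_) ((hA δ hδ z).1 x)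
    simp
  · intro z hx hy
    exact (hA δ hδ z).2 x y hxy ⟨List.mem_filterMap.1 hx, List.mem_filterMap.1 hy⟩

theorem simAccept_iff {o : Option (SimState Q k)} (ho : ∀ σ, o = some σ → TableValid σ.table) :
    (A.simAccept o).val = true ↔ ∃ σ, o = some σ ∧ σ.toConfig ∈ A.conf.accept := by
  cases o with
  | none => simp [simAccept]
  | some σ =>
    simp only [simAccept, Option.some.injEq, exists_eq_left']
    exact Formula.run_eq_true (isEnds_toMemory (ho σ rfl)) _

theorem time_simAccept (σ : SimState Q k) :
    (A.simAccept (some σ)).time ≤ 2 * (A.final σ.state).size := by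
  have h1 := (A.final σ.state).one_le_size
  have h2 := (A.final σ.state).time_run (e := σ.table.2)
  simp only [simAccept]
  omega

theorem one_le_size [Fintype Q] (A : CSA Q Sg k) (q : Q) : 1 ≤ A.size :=
  (Fintype.card_pos_iff.2 ⟨q⟩).trans_le (Nat.le_add_right _ _)

theorem size_le_of_mem [Fintype Q] {δ : Transition Q Sg k} (hδ : δ ∈ A.trans) : δ.size ≤ A.size :=
  (List.le_sum_of_mem (List.mem_map_of_mem hδ)).trans (Nat.le_add_left _ _)

variable [DecidableEq Q] [DecidableEq Sg]

theorem simStep_cases (A : CSA Q Sg k) (a : Sg) (σ : SimState Q k) :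
    ((findTrans σ.state a σ.table.2 A.trans).val = none ∧ (A.simStep a σ).val = none ∧
      (A.simStep a σ).time = (findTrans σ.state a σ.table.2 A.trans).time + 1) ∨
    ∃ δ, (findTrans σ.state a σ.table.2 A.trans).val = some δ ∧
      (A.simStep a σ).val = some ⟨δ.tgt, (runUpdate δ.upd σ.table.1).val⟩ ∧
      (A.simStep a σ).time = (findTrans σ.state a σ.table.2 A.trans).time
        + (runUpdate δ.upd σ.table.1).time + 1 := by
  unfold simStep
  dsimp only
  split
  · rename_i h; exact .inl ⟨h, rfl, rfl⟩
  · rename_i δ h; exact .inr ⟨δ, h, rfl, rfl⟩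

theorem step_of_simStep_eq_none {a : Sg} {σ : SimState Q k} (hσ : TableValid σ.table)
    (h : (A.simStep a σ).val = none) : A.conf.step σ.toConfig a = ∅ := by
  obtain ⟨h1, -, -⟩ | ⟨δ, -, h2, -⟩ := A.simStep_cases a σ
  · refine Set.eq_empty_of_forall_notMem ?_
    rintro c ⟨δ, hδ, hs, hl, hg, -⟩
    have := findTrans_eq_none h1 δ hδ hs hl
    rw [(Formula.run_eq_true (isEnds_toMemory hσ) δ.guard).2 hg] at this
    simp at this
  · simp [h2] at h

theorem mem_step_of_simStep_eq_some (hA : A.NonReplicating) {a : Sg} {σ σ' : SimState Q k}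
    (hσ : TableValid σ.table) (h : (A.simStep a σ).val = some σ') :
    TableValid σ'.table ∧ σ'.toConfig ∈ A.conf.step σ.toConfig a := by
  obtain ⟨-, h2, -⟩ | ⟨δ, h1, h2, -⟩ := A.simStep_cases a σ
  · simp [h2] at h
  · obtain rfl := Option.some.inj (h2.symm.trans h)
    obtain ⟨hδ, hs, hl, hg⟩ := findTrans_eq_some h1
    refine ⟨TableValid.runUpdate δ.upd hσ.file, δ, hδ, hs, hl,
      (Formula.run_eq_true (isEnds_toMemory hσ) δ.guard).1 hg, ?_⟩
    refine Prod.ext rfl (funext fun x => ?_)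
    exact toSet_runUpdate δ.upd hσ.file (hA.nodup hδ) x

/-- The prefix `v` witnesses that the current configuration is reachable, since determinism only
restricts reachable ones. It grows by one letter in each step of the induction. -/
theorem evalFrom_eq_simLoop (hA : A.IsDeterministic) (hA' : A.NonReplicating) (v w : List Sg)
    {σ : SimState Q k} (hσ : TableValid σ.table) (hv : σ.toConfig ∈ A.conf.eval v) :
    A.conf.evalFrom {σ.toConfig} w
      = {c | ∃ σ', (A.simLoop w σ).val = some σ' ∧ σ'.toConfig = c} := by
  induction w generalizing v σ with
  | nil => ext c; simp [simLoop, eq_comm]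
  | cons a w ih =>
    rw [NFA.evalFrom_cons, NFA.stepSet_singleton]
    simp only [simLoop]
    split
    · rename_i h
      rw [step_of_simStep_eq_none hσ h]
      have : A.conf.evalFrom ∅ w = ∅ := by
        rw [NFA.evalFrom_eq_biUnion_singleton]; simp
      simp [this]
    · rename_i σ' h
      obtain ⟨h1, h2⟩ := mem_step_of_simStep_eq_some hA' hσ h
      -- Other transitions may be enabled too, but they lead to the same configuration.
      rw [(hA.2 v _ hv a).eq_singleton_of_mem h2]
      refine ih (v ++ [a]) h1 ?_
      rw [NFA.eval_append_singleton]
      exact NFA.mem_stepSet.2 ⟨_, hv, h2⟩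

theorem tableValid_simLoop (hA : A.NonReplicating) (w : List Sg) {σ σ' : SimState Q k}
    (hσ : TableValid σ.table) (h : (A.simLoop w σ).val = some σ') : TableValid σ'.table := by
  induction w generalizing σ with
  | nil =>
    obtain rfl : σ = σ' := by simpa [simLoop] using h
    exact hσ
  | cons a w ih =>
    simp only [simLoop] at h
    split at h
    · simp at h
    · rename_i σ'' h1
      exact ih (mem_step_of_simStep_eq_some hA hσ h1).1 h

variable [Fintype Q]

theorem time_simStep_of_eq_none {a : Sg} {σ : SimState Q k} (h : (A.simStep a σ).val = none) :
    (A.simStep a σ).time ≤ 4 * A.size := by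
  have h0 := A.one_le_size σ.state
  have h3 := time_findTrans σ.state a σ.table.2 A.trans
  have h4 : (A.trans.map Transition.size).sum ≤ A.size := Nat.le_add_left _ _
  obtain ⟨-, -, h1⟩ | ⟨δ, -, h2, -⟩ := A.simStep_cases a σ
  · omega
  · simp [h2] at h

/-- The search and the constant overheads take `2 * A.size + 4`, the update `9 * A.size`, the bags
`3 * k` and the allocation `k`. With `k` and `1` at most `A.size`, this gives `19`. -/
theorem time_simStep_of_eq_some {a : Sg} {σ σ' : SimState Q k} (hσ : TableValid σ.table)
    (hb : File.bagSize σ.table.1 ≤ k) (h : (A.simStep a σ).val = some σ') :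
    k ≤ A.size ∧ File.bagSize σ'.table.1 ≤ k ∧
      (A.simStep a σ).time + File.weight σ'.table.1 ≤ File.weight σ.table.1 + 19 * A.size := by
  have h0 := A.one_le_size σ.state
  have h3 := time_findTrans σ.state a σ.table.2 A.trans
  have h4 : (A.trans.map Transition.size).sum ≤ A.size := Nat.le_add_left _ _
  obtain ⟨-, h2, -⟩ | ⟨δ, h1, h2, h5⟩ := A.simStep_cases a σ
  · simp [h2] at h
  · obtain rfl := Option.some.inj (h2.symm.trans h)
    have h6 := size_le_of_mem (findTrans_eq_some h1).1
    have h7 := δ.le_size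
    have h8 := time_runUpdate δ.upd hσ.file
    have h9 : ∑ x, (1 + ((δ.upd x).map RTerm.size).sum) ≤ δ.size := Nat.le_add_left _ _
    refine ⟨h7.trans h6, (bagSize_runUpdate δ.upd σ.table.1).trans hb, ?_⟩
    dsimp only
    omega

theorem time_simLoop (hA : A.NonReplicating) (w : List Sg) {σ : SimState Q k}
    (hσ : TableValid σ.table) (hb : File.bagSize σ.table.1 ≤ k) :
    (A.simLoop w σ).time ≤ File.weight σ.table.1 + 19 * (A.size * w.length) := by
  induction w generalizing σ with
  | nil => simp [simLoop]
  | cons a w ih =>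
    simp only [simLoop, List.length_cons, Nat.mul_succ]
    split
    · rename_i h
      have := time_simStep_of_eq_none h
      dsimp only
      omega
    · rename_i σ' h
      have h1 := time_simStep_of_eq_some hσ hb h
      have h2 := ih (mem_step_of_simStep_eq_some hA hσ h).1 h1.2.1
      dsimp only
      omega

theorem time_simRun (hA : A.NonReplicating) (α₀ : Config Q k) (w : List Sg) :
    (A.simRun α₀ w).time ≤ 22 * (A.size * w.length) := by
  cases w with
  | nil => simp [simRun, simLoop]
  | cons a w =>
    have h1 := time_simLoop hA (a :: w) (tableValid_simInit α₀) (bagSize_simInit α₀)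
    have h2 := weight_simInit α₀
    have h3 : A.size ≤ A.size * (a :: w).length := Nat.le_mul_of_pos_right _ (by simp)
    -- The initial potential `3 * k` is to be absorbed, but `k` may exceed `A.size` if there are no
    -- transitions. In that case the first letter already gets stuck. Otherwise a transition fires,
    -- `k ≤ A.size`, and `19 + 3 = 22`.
    by_cases h : (A.simStep a (simInit α₀).val).val = none
    · have h4 := time_simStep_of_eq_none h
      simp only [simRun, simLoop, h]
      omega
    · obtain ⟨σ', h⟩ := Option.ne_none_iff_exists'.1 h
      have h4 := (time_simStep_of_eq_some (tableValid_simInit α₀) (bagSize_simInit α₀) h).1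
      simp only [simRun]
      omega

end CSA

end CountingSet

theorem mainTheorem2 :
    ∃ C : ℕ, ∀ (Q : Type u) (Sg : Type v) (k : ℕ) [Fintype Q] [DecidableEq Q] [DecidableEq Sg]
      (A : CountingSet.CSA Q Sg k) (α₀ : CountingSet.Config Q k),
      A.IsDeterministic → A.init = {α₀} →
      (∀ x, α₀.2 x = ∅ ∨ ∃ n, α₀.2 x = {n}) →
      A.NonReplicating →
      ∀ w : List Sg,
        -- the simulation constructs the run of the automaton and decides acceptance
        A.conf.eval w = {c | ∃ σ, (A.simRun α₀ w).val = some σ ∧ σ.toConfig = c} ∧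
        ((A.simAccept (A.simRun α₀ w).val).val = true ↔ w ∈ A.language) ∧
        -- time for processing the letters of the word
        (A.simRun α₀ w).time ≤ C * (A.size * w.length) ∧
        -- time for setting up the initial configuration and for the final acceptance test
        (CountingSet.simInit α₀).time ≤ C * (k + 1) ∧
        (∀ σ, (A.simRun α₀ w).val = some σ →
          (A.simAccept (some σ)).time ≤ C * (A.final σ.state).size) ∧
        (A.simAccept none).time ≤ C := by
  refine ⟨22, fun Q Sg k _ _ _ A α₀ hdet hinit hα hrep w => ?_⟩
  have hrun : A.conf.evalFrom A.conf.start w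
      = {c | ∃ σ, (A.simRun α₀ w).val = some σ ∧ σ.toConfig = c} := by
    have h := CountingSet.CSA.evalFrom_eq_simLoop hdet hrep [] w
      (CountingSet.tableValid_simInit α₀)
    rw [CountingSet.toConfig_simInit α₀ hα] at h
    have hstart : A.conf.start = {α₀} := hinit
    rw [hstart]
    exact h (by rw [NFA.eval_nil, hstart]; rfl)
  refine ⟨hrun, ?_, CountingSet.CSA.time_simRun hrep α₀ w, ?_, fun σ _ => ?_, ?_⟩
  · rw [CountingSet.CSA.simAccept_iff (o := (A.simRun α₀ w).val) fun σ =>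
      CountingSet.CSA.tableValid_simLoop hrep w (CountingSet.tableValid_simInit α₀), CountingSet.CSA.language, NFA.mem_accepts, hrun]
    constructor
    · rintro ⟨σ, h, hσ⟩
      exact ⟨_, hσ, σ, h, rfl⟩
    · rintro ⟨_, hσ, σ, h, rfl⟩
      exact ⟨σ, h, hσ⟩
  · exact (CountingSet.time_simInit α₀).trans (Nat.mul_le_mul_right _ (by norm_num))
  · exact (CountingSet.CSA.time_simAccept σ).trans (Nat.mul_le_mul_right _ (by norm_num))
  · exact (by norm_num : 1 ≤ 22)
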